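/- Let $k$ be a finite field with $q$ elements, $F$ a finite field extension of $k$, $K$ a finite extension of $k(t)$, and $L/K$ a finite Galois extension with group $G$. Let $\mathcal O_K,\mathcal O_L$ be the integral closures of $k[t]$ in $K$ and $L$, let $z$ be the image of $t$ in them, and let $\rho:G\to\mathrm{GL}_F(V)$ be a representation on a finite dimensional $F$-vector space $V$. Let $n\ge 1$. For a finite $F[t]$-module $M$ put $|M|_{F[t]}=\det_{F[t]}(1\otimes t-t\otimes 1,\ M\otimes_F F[t])$, and likewise over $k$. For an $\mathcal O_K$-algebra $B$ let $C^{\otimes n}(B)$ be the $k$-vector space $B^n$ on which $t$ acts by $(x_1,\dots,x_{n-1},x_n)\mapsto(zx_1+x_2,\dots,zx_{n-1}+x_n,\,zx_n+x_1^q)$, and let $\mathrm{Lie}(C^{\otimes n})(B)$ be $B^n$ on which $t$ acts by the linear part $(x_1,\dots,x_n)\mapsto(zx_1+x_2,\dots,zx_{n-1}+x_n,\,zx_n)$. For a maximal ideal $\mathfrak p$ of $\mathcal O_K$ put $\kappa_{\mathfrak p}=\mathcal O_K/\mathfrak p$, choose a prime $\mathfrak P$ of $\mathcal O_L$ above $\mathfrak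 p$ with decomposition group $G_{\mathfrak P}$ and inertia group $I_{\mathfrak P}$, and let $\mathrm{Frob}_{\mathfrak P}\in G_{\mathfrak P}/I_{\mathfrak P}$ be the element acting on $\mathcal O_L/\mathfrak P$ as the $|\kappa_{\mathfrak p}|$-th power map. Let $V^{I_{\mathfrak P}}$ be the space of invariants and $V_{I_{\mathfrak P}}$ the space of coinvariants, i.e. the quotient of $V$ by the $F$-span of all $\rho(g)v-v$ with $g\in I_{\mathfrak P}$, $v\in V$. Define $$L(n,\rho)=\prod_{\mathfrak p}\det{}_{F[[t^{-1}]]}\Big(1-\frac{\rho(\mathrm{Frob}_{\mathfrak P})}{|\kappa_{\mathfrak p}|_{k[t]}^n},\ V^{I_{\mathfrak P}}[[t^{-1}]]\Big)^{-1},\qquad L(C^{\otimes n},\rho)=\prod_{\mathfrak p}\frac{|\mathrm{Hom}_{k[G]}(V,\mathrm{Lie}(C^{\otimes n})(\mathcal O_L/\mathfrak p\mathcal O_L))|_{F[t]}}{|\mathrm{Hom}_{k[G]}(V,C^{\otimes n}(\mathcal O_L/\mathfrak p\mathcal O_L))|_{F[t]}},$$ where $\mathfrak p$ runs over all maximal ideals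 of $\mathcal O_K$. Then these products and the product below converge in $F((t^{-1}))$ (unconditionally), and $$L(C^{\otimes n},\rho)=\prod_{\mathfrak p}\det{}_{F[[t^{-1}]]}\Big(1-\frac{\rho(\mathrm{Frob}_{\mathfrak P})}{|\kappa_{\mathfrak p}|_{k[t]}^n},\ V_{I_{\mathfrak P}}[[t^{-1}]]\Big)^{-1}\in 1+t^{-1}F[[t^{-1}]],\qquad \frac{L(n,\rho)}{L(C^{\otimes n},\rho)}\in F(t)^\times .$$ -/

import Mathlib

open scoped Polynomial PowerSeries LaurentSeries Pointwise TensorProduct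

noncomputable section

namespace CarlitzL

/-! ### The field `F((t⁻¹))`

`F[X]` is the polynomial ring `F[t]`, i.e. its variable `X` is `t`. The power series ring `F⟦X⟧` and
the Laurent series field `F⸨X⸩` are `F[[t⁻¹]]` and `F((t⁻¹))`, i.e. there the variable `X` is `t⁻¹`.
The topology on `F⸨X⸩` is Mathlib's one, given by the valuation of the variable `t⁻¹`. -/

section Infinity

variable {F : Type*} [Field F]

/-- The embedding `F[t] → F((t⁻¹))`: it is the identity on `F` and sends `t` to the inverse of the
variable of the Laurent series field. -/
def polyToLaurent : F[X] →+* F⸨X⸩ :=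
  Polynomial.eval₂RingHom HahnSeries.C (HahnSeries.single (-1) 1)

theorem polyToLaurent_coeff (P : F[X]) (m : ℕ) :
    (polyToLaurent P).coeff (-(m : ℤ)) = P.coeff m := by
  induction P using Polynomial.induction_on' with
  | add p q hp hq => simp [hp, hq]
  | monomial i a =>
    simp only [polyToLaurent, Polynomial.coe_eval₂RingHom, Polynomial.eval₂_monomial,
      HahnSeries.single_pow, HahnSeries.C_apply, HahnSeries.single_mul_single,
      HahnSeries.coeff_single, Polynomial.coeff_monomial]
    have h : (-(m : ℤ) = 0 + i • (-1 : ℤ)) ↔ i = m := by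
      simp only [nsmul_eq_mul]; omega
    simp only [h, one_pow, mul_one]

theorem polyToLaurent_injective : Function.Injective (polyToLaurent (F := F)) := by
  intro P Q h
  ext m
  rw [← polyToLaurent_coeff, ← polyToLaurent_coeff, h]

/-- The embedding `F(t) → F((t⁻¹))`. -/
def ratToLaurent : RatFunc F →+* F⸨X⸩ :=
  IsFractionRing.lift (polyToLaurent_injective (F := F))

/-- The expansion of `1 / P(t)` in `F[[t⁻¹]]` for a nonzero polynomial `P`:
`1 / P(t) = (t⁻¹) ^ d / (t ^ (-d) * P(t))` with `d = deg P`, and `t ^ (-d) * P(t)` is the reversed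
polynomial of `P` in the variable `t⁻¹`. -/
def invPoly (P : F[X]) : F⟦X⟧ :=
  PowerSeries.X ^ P.natDegree * ((P.reverse : F[X]) : F⟦X⟧)⁻¹

theorem polyToLaurent_mul_invPoly {P : F[X]} (hP : P ≠ 0) :
    polyToLaurent P * (invPoly P : F⸨X⸩) = 1 := by
  have h1 : (HahnSeries.single (1 : ℤ) (1 : F)) * HahnSeries.single (-1) 1 = 1 := by
    simp [HahnSeries.single_mul_single]
  let _ : Invertible (HahnSeries.single (-1 : ℤ) (1 : F)) :=
    ⟨HahnSeries.single 1 1, h1, by rw [mul_comm]; exact h1⟩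
  have h2 : ((P.reverse : F⟦X⟧) : F⸨X⸩) =
      Polynomial.eval₂ HahnSeries.C (HahnSeries.single (1 : ℤ) (1 : F)) P.reverse := by
    generalize P.reverse = Q
    induction Q using Polynomial.induction_on' with
    | add p q hp hq => simp [hp, hq]
    | monomial i a =>
      rw [Polynomial.eval₂_monomial, ← Polynomial.C_mul_X_pow_eq_monomial]
      simp
  have h3 := Polynomial.eval₂_reverse_mul_pow HahnSeries.C (HahnSeries.single (-1 : ℤ) (1 : F)) P
  have h4 : (P.reverse : F⟦X⟧) * (P.reverse : F⟦X⟧)⁻¹ = 1 :=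
    PowerSeries.mul_inv_cancel _ (by simp [hP])
  have h5 := congrArg (HahnSeries.ofPowerSeries ℤ F) h4
  rw [map_mul, map_one] at h5
  change Polynomial.eval₂ _ (HahnSeries.single (1 : ℤ) (1 : F)) _ * _ = _ at h3
  rw [← h2] at h3
  change Polynomial.eval₂ _ _ P * _ = 1
  rw [← h3, invPoly, map_mul, map_pow, HahnSeries.ofPowerSeries_X]
  calc _ = (HahnSeries.ofPowerSeries ℤ F (P.reverse : F⟦X⟧) *
        HahnSeries.ofPowerSeries ℤ F (P.reverse : F⟦X⟧)⁻¹) *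
        (HahnSeries.single (1 : ℤ) (1 : F) * HahnSeries.single (-1) 1) ^ P.natDegree := by
          rw [mul_pow]; ring
    _ = 1 := by rw [h5, h1, one_pow, one_mul]

/-- For an endomorphism `φ` of a finite dimensional `F`-vector space `W` and `u ∈ F[[t⁻¹]]`, this is
`det_{F[[t⁻¹]]}(1 - u * φ, W[[t⁻¹]])⁻¹`. -/
def eulerFactor {W : Type*} [AddCommGroup W] [Module F W] (u : F⟦X⟧) (φ : W →ₗ[F] W) : F⟦X⟧ :=
  (LinearMap.det (LinearMap.id - u • φ.baseChange F⟦X⟧ :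
    F⟦X⟧ ⊗[F] W →ₗ[F⟦X⟧] F⟦X⟧ ⊗[F] W))⁻¹

/-- The characteristic polynomial `|M|_{F[t]} = det_{F[t]}(1 ⊗ t - t ⊗ 1, M ⊗_F F[t])` of a finite
`F[t]`-module `M`, given as an `F`-vector space with the endomorphism `T` by which `t` acts. -/
def charPol {M : Type*} [AddCommGroup M] [Module F M] (T : M →ₗ[F] M) : F[X] :=
  LinearMap.det ((Polynomial.X : F[X]) • LinearMap.id - T.baseChange F[X] :
    F[X] ⊗[F] M →ₗ[F[X]] F[X] ⊗[F] M)

end Infinity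

/-! ### Tensor powers of the Carlitz module -/

section Carlitz

variable (k : Type*) [Field k] [Fintype k] (n : ℕ)
  (B : Type*) [CommRing B] [Algebra k B] [Algebra k[X] B] [IsScalarTower k k[X] B]

/-- `(x₁, …, xₙ) ↦ (z x₁ + x₂, …, z xₙ₋₁ + xₙ, z xₙ + x₁ ^ q)`, where `z` is the image of `t`
in `B` and `q = |k|`. -/
def carlitzT : (Fin n → B) →ₗ[k] (Fin n → B) where
  toFun x i := algebraMap k[X] B Polynomial.X * x i +
    if h : i.val + 1 < n then x ⟨i.val + 1, h⟩ else x ⟨0, i.pos⟩ ^ Fintype.card k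
  map_add' x y := by
    funext i
    have h0 : (x ⟨0, i.pos⟩ + y ⟨0, i.pos⟩) ^ Fintype.card k =
        x ⟨0, i.pos⟩ ^ Fintype.card k + y ⟨0, i.pos⟩ ^ Fintype.card k :=
      map_add (FiniteField.frobeniusAlgHom k B) _ _
    by_cases h : i.val + 1 < n
    · simp only [Pi.add_apply, h, dite_true]; ring
    · simp only [Pi.add_apply, h, dite_false, h0]; ring
  map_smul' a x := by
    funext i
    have h0 : (a • x ⟨0, i.pos⟩) ^ Fintype.card k = a • x ⟨0, i.pos⟩ ^ Fintype.card k :=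
      map_smul (FiniteField.frobeniusAlgHom k B) _ _
    by_cases h : i.val + 1 < n
    · simp only [Pi.smul_apply, h, dite_true, RingHom.id_apply, smul_add, mul_smul_comm]
    · simp only [Pi.smul_apply, h, dite_false, h0, RingHom.id_apply, smul_add, mul_smul_comm]

/-- The linear part of `carlitzT`:
`(x₁, …, xₙ) ↦ (z x₁ + x₂, …, z xₙ₋₁ + xₙ, z xₙ)`. -/
def carlitzLieT : (Fin n → B) →ₗ[k] (Fin n → B) where
  toFun x i := algebraMap k[X] B Polynomial.X * x i +
    if h : i.val + 1 < n then x ⟨i.val + 1, h⟩ else 0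
  map_add' x y := by
    funext i
    by_cases h : i.val + 1 < n
    · simp only [Pi.add_apply, h, dite_true]; ring
    · simp only [Pi.add_apply, h, dite_false]; ring
  map_smul' a x := by
    funext i
    by_cases h : i.val + 1 < n
    · simp only [Pi.smul_apply, h, dite_true, RingHom.id_apply, smul_add, mul_smul_comm]
    · simp only [Pi.smul_apply, h, dite_false, RingHom.id_apply, add_zero, mul_smul_comm]

/-- The `k[t]`-module structure `C^{⊗n} : k[t] → End_k(Bⁿ)` of `C^{⊗n}(B)`. -/
def carlitz : k[X] →ₐ[k] Module.End k (Fin n → B) := Polynomial.aeval (carlitzT k n B)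

/-- The `k[t]`-module structure of `Lie(C^{⊗n})(B) = Bⁿ`. -/
def carlitzLie : k[X] →ₐ[k] Module.End k (Fin n → B) := Polynomial.aeval (carlitzLieT k n B)

variable {k n B}

/-- The coordinatewise action on `Bⁿ` of a group `G` that acts on the `k[t]`-algebra `B`. -/
def coordRep {G : Type*} [Group G] (n : ℕ) (α : G →* (B →ₐ[k[X]] B)) :
    Representation k G (Fin n → B) where
  toFun g := ((α g).toLinearMap.restrictScalars k).compLeft (Fin n)
  map_one' := by ext x i; simp
  map_mul' g h := by ext x i; simp

theorem carlitz_coordRep {G : Type*} [Group G] (α : G →* (B →ₐ[k[X]] B)) (g : G) (x : Fin n → B) :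
    carlitz k n B Polynomial.X (coordRep n α g x) =
      coordRep n α g (carlitz k n B Polynomial.X x) := by
  have hz : α g (algebraMap k[X] B Polynomial.X) = algebraMap k[X] B Polynomial.X :=
    (α g).commutes _
  funext i
  by_cases h : i.val + 1 < n <;> simp [carlitz, carlitzT, coordRep, h, hz]

theorem carlitzLie_coordRep {G : Type*} [Group G] (α : G →* (B →ₐ[k[X]] B)) (g : G)
    (x : Fin n → B) :
    carlitzLie k n B Polynomial.X (coordRep n α g x) =
      coordRep n α g (carlitzLie k n B Polynomial.X x) := by
  have hz : α g (algebraMap k[X] B Polynomial.X) = algebraMap k[X] B Polynomial.X :=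
    (α g).commutes _
  funext i
  by_cases h : i.val + 1 < n <;> simp [carlitzLie, carlitzLieT, coordRep, h, hz]

end Carlitz

/-! ### The `F`-vector space `Hom_{k[G]}(V, M)` -/

section Hom

variable {k F G V M : Type*} [Field k] [Field F] [Algebra k F] [Group G]
  [AddCommGroup V] [Module k V] [Module F V] [IsScalarTower k F V] [AddCommGroup M] [Module k M]
  (ρ : Representation F G V) (τ : Representation k G M)

/-- The group `Hom_{k[G]}(V, M)` of `k[G]`-linear maps. -/
def homKG : AddSubgroup (V →ₗ[k] M) where
  carrier := {f | ∀ g v, f (ρ g v) = τ g (f v)}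
  zero_mem' := by simp
  add_mem' hf hf' g v := by simp [hf g v, hf' g v]
  neg_mem' hf g v := by simp [hf g v]

/-- `F` acts on `Hom_{k[G]}(V, M)` through `V`: `(a • f) v = f (a • v)`. -/
instance : Module F (homKG ρ τ) where
  smul a f := ⟨f.1 ∘ₗ (LinearMap.lsmul F V a).restrictScalars k, fun g v => by
    have := f.2 g (a • v)
    simpa using this⟩
  one_smul f := by ext v; change f.1 ((1 : F) • v) = _; simp
  mul_smul a b f := by
    ext v; change f.1 ((a * b) • v) = f.1 (b • a • v); rw [smul_smul, mul_comm]
  smul_zero a := by ext v; rfl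
  smul_add a f f' := by ext v; rfl
  add_smul a b f := by
    ext v; change f.1 ((a + b) • v) = f.1 (a • v) + f.1 (b • v); rw [add_smul, map_add]
  zero_smul f := by ext v; change f.1 ((0 : F) • v) = 0; simp

/-- The `F`-linear endomorphism `f ↦ T ∘ f` of `Hom_{k[G]}(V, M)` induced by a `k[G]`-linear
endomorphism `T` of `M`. -/
def homMap (T : Module.End k M) (hT : ∀ g x, T (τ g x) = τ g (T x)) :
    homKG ρ τ →ₗ[F] homKG ρ τ where
  toFun f := ⟨T ∘ₗ f.1, fun g v => by simp [f.2 g v, hT]⟩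
  map_add' f f' := by ext v; simp
  map_smul' a f := by ext v; rfl

end Hom

/-! ### The local factors and the `L`-values -/

section LValues

variable (k K L : Type*) [Field k] [Field K] [Field L]
  [Algebra k K] [Algebra k[X] K] [IsScalarTower k k[X] K]
  [Algebra K L] [Algebra k L] [Algebra k[X] L] [IsScalarTower k k[X] L] [IsScalarTower k[X] K L]

/-- The integral closure `O_K` of `k[t]` in `K`. -/
abbrev OInt : Subalgebra k[X] K := integralClosure k[X] K

/-- The inclusion `O_K → O_L`. -/
def inclO : OInt k K →ₐ[k[X]] OInt k L :=
  (IsScalarTower.toAlgHom k[X] K L).mapIntegralClosure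

variable {k K}

/-- `|κ_𝔭|_{k[t]}`, the characteristic polynomial of the `k[t]`-module `κ_𝔭 = O_K / 𝔭`. -/
def residuePol (𝔭 : Ideal (OInt k K)) : k[X] :=
  charPol (LinearMap.mulLeft k (algebraMap k[X] (OInt k K ⧸ 𝔭) Polynomial.X))

theorem smul_mem_map_inclO (𝔭 : Ideal (OInt k K)) (g : Gal(L/K)) :
    𝔭.map (inclO k K L) ≤
      (𝔭.map (inclO k K L)).comap (MulSemiringAction.toAlgHom k[X] (OInt k L) g) := by
  rw [Ideal.map_le_iff_le_comap]
  intro x hx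
  have : MulSemiringAction.toAlgHom k[X] (OInt k L) g (inclO k K L x) = inclO k K L x :=
    Subtype.ext (g.commutes (x : K))
  simp only [Ideal.mem_comap]
  rw [this]
  exact Ideal.mem_map_of_mem _ hx

/-- The ring `O_L / 𝔭 O_L`. -/
def quotO (𝔭 : Ideal (OInt k K)) : Type _ := OInt k L ⧸ 𝔭.map (inclO k K L)

instance (𝔭 : Ideal (OInt k K)) : CommRing (quotO L 𝔭) :=
  Ideal.Quotient.commRing (𝔭.map (inclO k K L))

instance (𝔭 : Ideal (OInt k K)) : Algebra k[X] (quotO L 𝔭) :=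
  Ideal.Quotient.algebra k[X] (I := 𝔭.map (inclO k K L))

instance (𝔭 : Ideal (OInt k K)) : Algebra k (quotO L 𝔭) :=
  Ideal.Quotient.algebra k (I := 𝔭.map (inclO k K L))

instance (𝔭 : Ideal (OInt k K)) : IsScalarTower k k[X] (quotO L 𝔭) :=
  Ideal.Quotient.isScalarTower k k[X] (𝔭.map (inclO k K L))

/-- The action of `G = Gal(L/K)` on `O_L / 𝔭 O_L`. -/
def galQuot (𝔭 : Ideal (OInt k K)) : Gal(L/K) →* (quotO L 𝔭 →ₐ[k[X]] quotO L 𝔭) where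
  toFun g :=
    Ideal.quotientMapₐ _ (MulSemiringAction.toAlgHom k[X] (OInt k L) g) (smul_mem_map_inclO L 𝔭 g)
  map_one' := by
    refine AlgHom.ext fun x => ?_
    obtain ⟨y, rfl⟩ := Ideal.Quotient.mk_surjective x
    exact congrArg (Ideal.Quotient.mk _) (one_smul Gal(L/K) y)
  map_mul' g h := by
    refine AlgHom.ext fun x => ?_
    obtain ⟨y, rfl⟩ := Ideal.Quotient.mk_surjective x
    exact congrArg (Ideal.Quotient.mk _) (mul_smul g h y)

/-- The coordinatewise action of `G = Gal(L/K)` on `(O_L / 𝔭 O_L)ⁿ`. -/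
def quotRep (n : ℕ) (𝔭 : Ideal (OInt k K)) : Representation k Gal(L/K) (Fin n → quotO L 𝔭) :=
  coordRep n (galQuot L 𝔭)

variable {F V : Type*} [Fintype k] [Field F] [Algebra k F] [AddCommGroup V] [Module k V]
  [Module F V] [IsScalarTower k F V]

variable {L} (ρ : Representation F Gal(L/K) V) (n : ℕ)

/-- `|Hom_{k[G]}(V, C^{⊗n}(O_L / 𝔭 O_L))|_{F[t]}` -/
def carlitzPol (𝔭 : Ideal (OInt k K)) : F[X] :=
  charPol (homMap ρ (quotRep L n 𝔭) (carlitz k n (quotO L 𝔭) Polynomial.X)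
    (carlitz_coordRep (galQuot L 𝔭)))

/-- `|Hom_{k[G]}(V, Lie(C^{⊗n})(O_L / 𝔭 O_L))|_{F[t]}` -/
def carlitzLiePol (𝔭 : Ideal (OInt k K)) : F[X] :=
  charPol (homMap ρ (quotRep L n 𝔭) (carlitzLie k n (quotO L 𝔭) Polynomial.X)
    (carlitzLie_coordRep (galQuot L 𝔭)))

/-- The factor of `L(C^{⊗n}, ρ)` at `𝔭`. -/
def carlitzFactor (𝔭 : Ideal (OInt k K)) : F⸨X⸩ :=
  polyToLaurent (carlitzLiePol ρ n 𝔭) / polyToLaurent (carlitzPol ρ n 𝔭)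

/-- `L(C^{⊗n}, ρ)`. -/
def carlitzLValue : F⸨X⸩ :=
  ∏' 𝔭 : MaximalSpectrum (OInt k K), carlitzFactor ρ n 𝔭.asIdeal

/-- The decomposition group `G_𝔓`. -/
abbrev decomp (𝔓 : Ideal (OInt k L)) : Subgroup Gal(L/K) := MulAction.stabilizer Gal(L/K) 𝔓

/-- The inertia group `I_𝔓`, as a normal subgroup of the decomposition group. -/
abbrev inert (𝔓 : Ideal (OInt k L)) : Subgroup (decomp (K := K) 𝔓) := 𝔓.inertia (decomp 𝔓)

/-- `det_{F[[t⁻¹]]}(1 - ρ(σ) / |κ_𝔭|ⁿ, V_{I_𝔓}[[t⁻¹]])⁻¹` for `σ ∈ G_𝔓`, where `V_{I_𝔓}` is the space of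
coinvariants, the quotient of `V` by the span of all `ρ(g) v - v` with `g ∈ I_𝔓`. -/
def coinvFactor (𝔭 : Ideal (OInt k K)) (𝔓 : Ideal (OInt k L)) (σ : decomp (K := K) 𝔓) : F⟦X⟧ :=
  eulerFactor (invPoly ((residuePol 𝔭).map (algebraMap k F)) ^ n)
    (Representation.toCoinvariants (ρ.comp (decomp 𝔓).subtype) (inert 𝔓) σ)

/-- `det_{F[[t⁻¹]]}(1 - ρ(σ) / |κ_𝔭|ⁿ, V^{I_𝔓}[[t⁻¹]])⁻¹` for `σ ∈ G_𝔓`, where `V^{I_𝔓}` is the space of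
invariants. -/
def invFactor (𝔭 : Ideal (OInt k K)) (𝔓 : Ideal (OInt k L)) (σ : decomp (K := K) 𝔓) : F⟦X⟧ :=
  eulerFactor (invPoly ((residuePol 𝔭).map (algebraMap k F)) ^ n)
    (Representation.toInvariants (ρ.comp (decomp 𝔓).subtype) (inert 𝔓) σ)

/-- `L(n, ρ)`, computed with primes `𝔓` of `O_L` above the primes `𝔭` and with elements of the
decomposition groups that lift the Frobenius elements. -/
def artinLValue (P : MaximalSpectrum (OInt k K) → Ideal (OInt k L))
    (σ : ∀ 𝔭, decomp (K := K) (P 𝔭)) : F⸨X⸩ :=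
  ∏' 𝔭 : MaximalSpectrum (OInt k K), (invFactor ρ n 𝔭.asIdeal (P 𝔭) (σ 𝔭) : F⸨X⸩)

end LValues

end CarlitzL

end

/-!
The theorem is local: for each maximal ideal `𝔭` the factor of `L(C^{⊗n}, ρ)` is equal to the Euler
factor on the coinvariants of inertia (`carlitzFactor_eq_coinvFactor`), and everything else follows
from the shape of Euler factors.

For the local statement let `B = O_L / 𝔭 O_L`, let `l` be the residue field of `𝔓`, let
`d = [κ_𝔭 : k]` and let `E` be an algebraic closure of `F`. A `k`-linear map `f : V → l` has
Frobenius twists `v ↦ f v ^ q ^ i`, and each of them has an `F`-linear part, a linear form on `V`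
with values in `E` (`twistPart`); together they determine `f`. If `f` is the reduction of a
coordinate of an element of `Hom_{k[G]}(V, Bⁿ)`, then the forms are invariant under inertia, and
`d` twists amount to composition with the Frobenius element. Hence the twists with `i < d`, evaluated on representatives
of a basis of `V_I`, define an `F`-linear map from `Hom_{k[G]}(V, Bⁿ)` to `E ^ (d * n * r)`, with
`r = dim V_I` (`residueMap`). Its kernel consists of the maps with nilpotent values
(`residueMap_ker`), and its image is an `F`-form of the target (`residueMap_linearIndependent`,
`residueMap_span`; the second one rests on the Chinese remainder theorem for the primes above `𝔭`).
On the kernel the two actions of `t` have the same characteristic polynomial, since they differ by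
`x ↦ x ^ q`, which increases the degree in the filtration by the powers of the nilradical
(`charpoly_restrict_ker_eq`). On the target, `t` acts through the Carlitz module by a cyclic block
matrix: the conjugates of the image `z` of `t` on the diagonal, each `n` times, ones beside the
diagonal, and the matrix `S` of Frobenius on `V_I` in the corner (`residueMap_carlitz`). Its
characteristic polynomial is `det (fⁿ - S)` with `f = ∏ (t - z ^ q ^ i) = |κ_𝔭|`, whereas the linear
part gives `det (fⁿ)` (`charPol_carlitz`). The quotient is `det (1 - f⁻ⁿ S)⁻¹`.

The Euler factor at `𝔭` is congruent to `1` modulo `t^{-d}`, and there are finitely many `𝔭` of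
bounded degree, so that the products converge (`exists_hasProd_of_X_pow_finrank_dvd`). The Euler
factors on the invariants and on the coinvariants agree unless `𝔭` ramifies, which happens for
finitely many `𝔭` only (`finite_setOf_inert_ne_bot`), and each of them is a rational function. So
the quotient of the two products is a rational function.
-/

noncomputable section

/-! ### Characteristic polynomials and cyclic block matrices -/

section Charpoly

open Module

/-- The polynomial `|M|_{F[t]}` is the characteristic polynomial of `t` on `M`. -/
theorem CarlitzL.charPol_eq_charpoly {F M : Type*} [Field F] [AddCommGroup M] [Module F M]
    [FiniteDimensional F M] (T : M →ₗ[F] M) : CarlitzL.charPol T = T.charpoly := by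
  classical
  let b := Module.finBasis F M
  rw [CarlitzL.charPol, ← LinearMap.charpoly_toMatrix T b, Matrix.charpoly,
    ← LinearMap.det_toMatrix (b.baseChange F[X])]
  congr 1
  ext1 i j
  by_cases h : i = j
  · subst h
    simp [LinearMap.toMatrix_apply, Matrix.charmatrix_apply_eq, Algebra.smul_def]
  · simp [LinearMap.toMatrix_apply, Algebra.smul_def, h]

/-- The characteristic polynomial is multiplicative along an invariant subspace. -/
theorem LinearMap.charpoly_eq_mul_of_invariant {F M : Type*} [Field F] [AddCommGroup M]
    [Module F M] [FiniteDimensional F M] (W : Submodule F M) (e : M →ₗ[F] M)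
    (he : W ≤ W.comap e) :
    e.charpoly = (e.restrict he).charpoly * (W.mapQ W e he).charpoly := by
  classical
  let bW := Module.finBasis F W
  let bQ := Module.finBasis F (M ⧸ W)
  let b := Basis.sumQuot bW bQ
  let A := LinearMap.toMatrix bW bW (e.restrict he)
  let B := Matrix.of fun i l ↦
    ((Basis.sumQuot bW bQ).repr (e ((Basis.sumQuot bW bQ) (Sum.inr l)))) (Sum.inl i)
  let D := LinearMap.toMatrix bQ bQ (W.mapQ W e he)
  suffices LinearMap.toMatrix b b e = Matrix.fromBlocks A B 0 D by
    rw [← LinearMap.charpoly_toMatrix _ b, this, ← LinearMap.charpoly_toMatrix _ bW,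
      ← LinearMap.charpoly_toMatrix _ bQ, Matrix.charpoly_fromBlocks_zero₂₁]
  ext u v
  cases u with
  | inl i =>
    cases v with
    | inl k =>
      simp only [b, Basis.sumQuot_inl, Matrix.fromBlocks_apply₁₁, A, LinearMap.toMatrix_apply]
      apply Basis.sumQuot_repr_inl_of_mem
    | inr l => simp [b, LinearMap.toMatrix_apply, Matrix.fromBlocks_apply₁₂, B]
  | inr j =>
    cases v with
    | inl k =>
      suffices W.mkQ (e (bW k)) = 0 by simp [LinearMap.toMatrix_apply, b, this]
      rw [← LinearMap.mem_ker, Submodule.ker_mkQ]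
      exact he (Submodule.coe_mem (bW k))
    | inr l =>
      simp only [LinearMap.toMatrix_apply, Basis.sumQuot_repr_inr, Matrix.fromBlocks_apply₂₂, b, D]
      rw [← Basis.sumQuot_inr bW bQ l, W.mapQ_apply]
      simp

/-- If `A` preserves a finite filtration and `A - A'` raises it by one step, then `A` and `A'`
have the same characteristic polynomial: they induce the same maps on the graded pieces. -/
theorem LinearMap.charpoly_eq_of_filtration {F M : Type*} [Field F] [AddCommGroup M]
    [Module F M] [FiniteDimensional F M] (r : ℕ) (p : ℕ → Submodule F M) (hp : Antitone p)
    (h0 : p 0 = ⊤) (hr : p r = ⊥) (A A' : M →ₗ[F] M) (hA : ∀ i, ∀ x ∈ p i, A x ∈ p i)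
    (hD : ∀ i, ∀ x ∈ p i, A x - A' x ∈ p (i + 1)) : A.charpoly = A'.charpoly := by
  induction r generalizing M with
  | zero =>
    have hx : ∀ x : M, x = 0 := fun x => by
      have : x ∈ p 0 := h0 ▸ Submodule.mem_top
      rwa [hr, Submodule.mem_bot] at this
    congr 1
    ext x
    rw [hx x, map_zero, map_zero]
  | succ r ih =>
    have hA' : ∀ i, ∀ x ∈ p i, A' x ∈ p i := fun i x hx => by
      have := (p i).sub_mem (hA i x hx) (hp (Nat.le_succ i) (hD i x hx))
      rwa [sub_sub_cancel] at this
    rw [A.charpoly_eq_mul_of_invariant (p 1) (hA 1), A'.charpoly_eq_mul_of_invariant (p 1) (hA' 1)]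
    congr 1
    · refine ih (fun i => (p (i + 1)).comap (p 1).subtype)
        (fun i j hij => Submodule.comap_mono (hp (Nat.succ_le_succ hij))) ?_ ?_ _ _ ?_ ?_
      · simp
      · simp only [hr]
        simp
      · intro i x hx
        exact hA _ _ hx
      · intro i x hx
        exact hD _ _ hx
    · congr 1
      ext x
      simp only [coe_comp, Function.comp_apply, Submodule.mkQ_apply, Submodule.mapQ_apply]
      rw [Submodule.Quotient.eq]
      exact hD 0 x (h0 ▸ Submodule.mem_top)

/-- Let `φ : M → Y` be an `F`-linear map to an `E`-vector space whose image is an `F`-form of `Y`,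
and let `A'` be compatible with `A`. Then up to extension of scalars `A` has the characteristic
polynomial of `A'`, times that of the restriction of `A` to the kernel of `φ`. -/
theorem LinearMap.map_charpoly_eq_mul_of_form {F E M Y : Type*} [Field F] [Field E] [Algebra F E]
    [AddCommGroup M] [Module F M] [FiniteDimensional F M] [AddCommGroup Y] [Module F Y]
    [Module E Y] [IsScalarTower F E Y] [FiniteDimensional E Y] (φ : M →ₗ[F] Y)
    (hspan : Submodule.span E (Set.range φ) = ⊤)
    (hind : ∀ (m : ℕ) (v : Fin m → M), LinearIndependent F (φ ∘ v) → LinearIndependent E (φ ∘ v))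
    (A : M →ₗ[F] M) (A' : Y →ₗ[E] Y) (h : ∀ x, φ (A x) = A' (φ x))
    (hA : LinearMap.ker φ ≤ (LinearMap.ker φ).comap A) :
    A.charpoly.map (algebraMap F E) =
      (A.restrict hA).charpoly.map (algebraMap F E) * A'.charpoly := by
  classical
  rw [A.charpoly_eq_mul_of_invariant _ hA, Polynomial.map_mul]
  congr 1
  let b := Module.finBasis F (M ⧸ LinearMap.ker φ)
  choose v hv using fun i => Submodule.Quotient.mk_surjective _ (b i)
  let ψ : (M ⧸ LinearMap.ker φ) →ₗ[F] Y := (LinearMap.ker φ).liftQ φ le_rfl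
  have hψ : LinearMap.ker ψ = ⊥ := Submodule.ker_liftQ_eq_bot _ _ _ le_rfl
  have hψv : ∀ i, ψ (b i) = φ (v i) := fun i => by
    rw [← hv i]; rfl
  have hF : LinearIndependent F (φ ∘ v) := by
    have := b.linearIndependent.map' ψ hψ
    have e : ψ ∘ b = φ ∘ v := funext hψv
    rwa [e] at this
  have hs : ⊤ ≤ Submodule.span E (Set.range (φ ∘ v)) := by
    rw [← hspan, Submodule.span_le]
    rintro _ ⟨x, rfl⟩
    have hx : φ x = ψ (Submodule.Quotient.mk x) := rfl
    rw [hx, ← b.sum_repr (Submodule.Quotient.mk x), map_sum]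
    refine Submodule.sum_mem _ fun i _ => ?_
    rw [map_smul, hψv, ← IsScalarTower.algebraMap_smul E]
    exact Submodule.smul_mem _ _ (Submodule.subset_span ⟨i, rfl⟩)
  let b' : Basis _ E Y := Basis.mk (hind _ v hF) hs
  have hb' : ∀ i, b' i = ψ (b i) := fun i => by
    rw [hψv, Basis.mk_apply]; rfl
  rw [← LinearMap.charpoly_toMatrix _ b, ← LinearMap.charpoly_toMatrix _ b', ← Matrix.charpoly_map]
  congr 1
  ext i j
  have hcomm : ∀ y, ψ ((LinearMap.ker φ).mapQ _ A hA y) = A' (ψ y) := fun y => by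
    obtain ⟨x, rfl⟩ := Submodule.Quotient.mk_surjective _ y
    exact h x
  have hsum : A' (b' j) =
      ∑ l, algebraMap F E (b.repr ((LinearMap.ker φ).mapQ _ A hA (b j)) l) • b' l := by
    rw [hb', ← hcomm]
    conv_lhs => rw [← b.sum_repr ((LinearMap.ker φ).mapQ _ A hA (b j)), map_sum]
    refine Finset.sum_congr rfl fun l _ => ?_
    rw [map_smul, hb', IsScalarTower.algebraMap_smul]
  rw [Matrix.map_apply, LinearMap.toMatrix_apply, LinearMap.toMatrix_apply, hsum,
    Basis.repr_sum_self]

end Charpoly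

section CyclicMatrix

variable {R : Type*} [CommRing R] {N r : ℕ}

/-- The block matrix with `N × N` blocks of size `r`, with scalar diagonal blocks `a p`, scalar
blocks `ε p` next to the right of the diagonal, and `S` added to the lower left block. -/
def cyclicBlockMatrix (a ε : Fin N → R) (S : Matrix (Fin r) (Fin r) R) :
    Matrix (Fin N × Fin r) (Fin N × Fin r) R := Matrix.of fun x y =>
  (if x.1 = y.1 ∧ x.2 = y.2 then a x.1 else 0) +
    (if y.1.val = x.1.val + 1 ∧ x.2 = y.2 then ε x.1 else 0) +
    (if x.1.val + 1 = N ∧ y.1.val = 0 then S x.2 y.2 else 0)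

theorem cyclicBlockMatrix_apply (a ε : Fin N → R) (S : Matrix (Fin r) (Fin r) R)
    (x y : Fin N × Fin r) : cyclicBlockMatrix a ε S x y =
      (if x.1 = y.1 ∧ x.2 = y.2 then a x.1 else 0) +
        (if y.1.val = x.1.val + 1 ∧ x.2 = y.2 then ε x.1 else 0) +
        (if x.1.val + 1 = N ∧ y.1.val = 0 then S x.2 y.2 else 0) := rfl

theorem map_cyclicBlockMatrix {R' : Type*} [CommRing R'] (f : R →+* R') (a ε : Fin N → R)
    (S : Matrix (Fin r) (Fin r) R) :
    (cyclicBlockMatrix a ε S).map f = cyclicBlockMatrix (f ∘ a) (f ∘ ε) (S.map f) := by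
  ext x y
  simp [cyclicBlockMatrix_apply, apply_ite f]

theorem charmatrix_cyclicBlockMatrix (a ε : Fin N → R) (S : Matrix (Fin r) (Fin r) R) :
    (cyclicBlockMatrix a ε S).charmatrix =
      cyclicBlockMatrix (fun p => Polynomial.X - Polynomial.C (a p))
        (fun p => - Polynomial.C (ε p)) (- S.map Polynomial.C) := by
  ext1 x y
  rw [Matrix.charmatrix_apply, Matrix.diagonal_apply]
  simp only [cyclicBlockMatrix_apply, Prod.ext_iff]
  simp only [map_add, apply_ite Polynomial.C, map_zero, Matrix.neg_apply, Matrix.map_apply]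
  split_ifs <;> ring

theorem cyclicBlockMatrix_zero_det (a ε : Fin N → R) :
    (cyclicBlockMatrix a ε (0 : Matrix (Fin r) (Fin r) R)).det = (∏ p, a p) ^ r := by
  classical
  let U : Matrix (Fin N) (Fin N) R := Matrix.of fun p q =>
    (if p = q then a p else 0) + (if q.val = p.val + 1 then ε p else 0)
  have h : cyclicBlockMatrix a ε (0 : Matrix (Fin r) (Fin r) R) =
      Matrix.kroneckerMap (· * ·) U 1 := by
    ext x y
    simp only [cyclicBlockMatrix_apply, U, Matrix.of_apply, Matrix.kroneckerMap_apply,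
      Matrix.one_apply, Matrix.zero_apply, ite_self, add_zero]
    by_cases h : x.2 = y.2 <;> simp [h]
  have hU : U.det = ∏ p, a p := by
    rw [Matrix.det_of_isUpperTriangular]
    · simp [U]
    · intro p q hpq
      have hpq' : q < p := hpq
      have h1 : p ≠ q := hpq'.ne'
      have h2 : ¬ q.val = p.val + 1 := by
        have : q.val < p.val := hpq'
        omega
      simp [U, h1, h2]
  rw [h, Matrix.det_kronecker, hU]
  simp

theorem cyclicBlockMatrix_mulVec (a ε : Fin N → R) (S : Matrix (Fin r) (Fin r) R)
    (y : Fin N × Fin r → R) (p : Fin N) (s : Fin r) :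
    (cyclicBlockMatrix a ε S).mulVec y (p, s) =
      a p * y (p, s) + (if h : p.val + 1 < N then ε p * y (⟨p.val + 1, h⟩, s) else
        ∑ s', S s s' * y (⟨0, p.pos⟩, s')) := by
  classical
  simp only [Matrix.mulVec, dotProduct, cyclicBlockMatrix_apply, add_mul, Finset.sum_add_distrib]
  rw [add_assoc]
  congr 1
  · rw [Finset.sum_eq_single (p, s)]
    · simp
    · rintro ⟨p', s'⟩ _ hne
      rw [if_neg, zero_mul]
      rintro ⟨h1, h2⟩
      exact hne (Prod.ext h1.symm h2.symm)
    · simp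
  · split_ifs with h
    · rw [Finset.sum_eq_single (⟨p.val + 1, h⟩, s)]
      · have : ¬ (p.val + 1 = N) := by omega
        simp [this]
      · rintro ⟨p', s'⟩ _ hne
        rw [if_neg, zero_mul]
        rintro ⟨h1, h2⟩
        exact hne (Prod.ext (Fin.ext h1) h2.symm)
      · simp
    · have hN : p.val + 1 = N := by omega
      rw [Finset.sum_eq_zero, zero_add, Fintype.sum_prod_type,
        Finset.sum_eq_single (⟨0, p.pos⟩ : Fin N)]
      · simp [hN]
      · intro p' _ hne
        refine Finset.sum_eq_zero fun s' _ => ?_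
        rw [if_neg, zero_mul]
        rintro ⟨-, h2⟩
        exact hne (Fin.ext h2)
      · simp
      · rintro ⟨p', s'⟩ _
        rw [if_neg, zero_mul]
        rintro ⟨h1, -⟩
        have := p'.isLt
        simp only at h1
        omega

/-- The matrix determinant lemma for the lower left block: it multiplies the determinant by that of
`1 - S / ∏ a p`, where `∏ (a p)⁻¹` is the upper right block of the inverse of the bidiagonal
part. -/
theorem det_cyclicBlockMatrix_of_field {K : Type*} [Field K] (hN : 0 < N) (a : Fin N → K)
    (ha : ∀ p, a p ≠ 0) (S : Matrix (Fin r) (Fin r) K) :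
    (cyclicBlockMatrix a (fun _ => -1) (-S)).det =
      ((∏ p, a p) • (1 : Matrix (Fin r) (Fin r) K) - S).det := by
  classical
  set A := cyclicBlockMatrix a (fun _ => -1) (0 : Matrix (Fin r) (Fin r) K) with hA
  have hdet : A.det = (∏ p, a p) ^ r := cyclicBlockMatrix_zero_det _ _
  have hprod : (∏ p, a p) ≠ 0 := Finset.prod_ne_zero_iff.2 fun p _ => ha p
  have hunit : IsUnit A.det := by
    rw [hdet]
    exact (pow_ne_zero _ hprod).isUnit
  let U : Matrix (Fin N × Fin r) (Fin r) K := Matrix.of fun x s =>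
    if x.1.val + 1 = N then -S x.2 s else 0
  let V : Matrix (Fin r) (Fin N × Fin r) K := Matrix.of fun s y =>
    if y.1.val = 0 then (if s = y.2 then 1 else 0) else 0
  let Z : Matrix (Fin N × Fin r) (Fin r) K := Matrix.of fun x s =>
    -S x.2 s * ∏ p ∈ Finset.univ.filter (fun p => x.1 ≤ p), (a p)⁻¹
  have hUV : cyclicBlockMatrix a (fun _ => -1) (-S) = A + U * V := by
    ext x y
    simp only [hA, Matrix.add_apply, Matrix.mul_apply, cyclicBlockMatrix_apply, U, V,
      Matrix.of_apply, Matrix.zero_apply, ite_self, add_zero, Matrix.neg_apply]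
    congr 1
    by_cases h1 : x.1.val + 1 = N <;> by_cases h2 : y.1.val = 0 <;> simp [h1, h2]
  have hAZ : A * Z = U := by
    ext ⟨p, s⟩ t
    change (A.mulVec fun x => Z x t) (p, s) = _
    rw [cyclicBlockMatrix_mulVec]
    have hcons : ∀ h : p.val + 1 < N, ∏ q ∈ Finset.univ.filter (fun q => p ≤ q), (a q)⁻¹ =
        (a p)⁻¹ * ∏ q ∈ Finset.univ.filter (fun q => (⟨p.val + 1, h⟩ : Fin N) ≤ q), (a q)⁻¹ := by
      intro h
      rw [← Finset.prod_insert (f := fun q => (a q)⁻¹) (by simp [Fin.le_def])]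
      congr 1
      ext q
      simp only [Finset.mem_filter, Finset.mem_univ, true_and, Finset.mem_insert, Fin.le_def,
        Fin.ext_iff]
      omega
    split_ifs with h
    · have h' : ¬ (p.val + 1 = N) := by omega
      simp only [Z, U, Matrix.of_apply, h', if_false, hcons h]
      field_simp [ha p]
      ring
    · have h' : p.val + 1 = N := by omega
      have h3 : Finset.univ.filter (fun q => p ≤ q) = {p} := by
        ext q
        have := q.isLt
        simp only [Finset.mem_filter, Finset.mem_univ, true_and, Finset.mem_singleton, Fin.le_def,
          Fin.ext_iff]
        omega
      simp only [Z, U, Matrix.of_apply, h', if_true, h3, Finset.prod_singleton,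
        Matrix.zero_apply, zero_mul, Finset.sum_const_zero, add_zero]
      field_simp [ha p]
  have hVZ : V * Z = -((∏ p, a p)⁻¹ • S) := by
    ext s t
    rw [Matrix.mul_apply, Fintype.sum_prod_type, Finset.sum_eq_single (⟨0, hN⟩ : Fin N)]
    · simp only [V, Z, Matrix.of_apply, if_true, Fin.le_def, Nat.zero_le, Finset.filter_true,
        ite_mul, one_mul, zero_mul, Finset.sum_ite_eq, Finset.mem_univ, Matrix.neg_apply,
        Matrix.smul_apply, smul_eq_mul, Finset.prod_inv_distrib]
      ring
    · intro p _ hne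
      refine Finset.sum_eq_zero fun s' _ => ?_
      have : p.val ≠ 0 := fun h => hne (Fin.ext h)
      simp only [V, Matrix.of_apply, this, if_false, zero_mul]
    · simp
  rw [hUV, Matrix.det_add_mul _ _ hunit, Matrix.mul_assoc]
  have : A⁻¹ * U = Z := by
    rw [← hAZ, Matrix.nonsing_inv_mul_cancel_left _ _ hunit]
  rw [this, hVZ, hdet]
  have hs : (∏ p, a p) • (1 : Matrix (Fin r) (Fin r) K) - S =
      (∏ p, a p) • (1 + -((∏ p, a p)⁻¹ • S)) := by
    rw [smul_add, smul_neg, smul_smul, mul_inv_cancel₀ hprod, one_smul, sub_eq_add_neg]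
  rw [hs, Matrix.det_smul, Fintype.card_fin]

theorem det_cyclicBlockMatrix [IsDomain R] (hN : 0 < N) (a : Fin N → R)
    (ha : ∀ p, a p ≠ 0) (S : Matrix (Fin r) (Fin r) R) :
    (cyclicBlockMatrix a (fun _ => -1) (-S)).det =
      ((∏ p, a p) • (1 : Matrix (Fin r) (Fin r) R) - S).det := by
  classical
  suffices H : ∀ (K : Type _) [Field K] [Algebra R K] [FaithfulSMul R K],
      (cyclicBlockMatrix a (fun _ => -1) (-S)).det =
        ((∏ p, a p) • (1 : Matrix (Fin r) (Fin r) R) - S).det from H (FractionRing R)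
  intro K _ _ _
  apply FaithfulSMul.algebraMap_injective R K
  have key := det_cyclicBlockMatrix_of_field hN (fun p => algebraMap R K (a p))
    (fun p => by simpa using ha p) (S.map (algebraMap R K))
  rw [RingHom.map_det, RingHom.map_det, RingHom.mapMatrix_apply, RingHom.mapMatrix_apply,
    map_cyclicBlockMatrix]
  convert key using 2
  · congr 1
    · ext; simp
    · ext; simp
  · ext i j
    simp [Matrix.one_apply, apply_ite (algebraMap R K)]

end CyclicMatrix

/-! ### Convergence of products and Euler factors in `F((t⁻¹))` -/

section InfiniteProducts

variable {F : Type*} [Field F] {ι : Type*}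

theorem PowerSeries.X_pow_dvd_prod_sub_one (f : ι → F⟦X⟧) (N : ℕ) (t : Finset ι)
    (h : ∀ i ∈ t, PowerSeries.X ^ N ∣ f i - 1) : PowerSeries.X ^ N ∣ (∏ i ∈ t, f i) - 1 := by
  simp only [← Ideal.mem_span_singleton, ← Ideal.Quotient.mk_eq_mk_iff_sub_mem] at h ⊢
  rw [map_prod, map_one]
  exact Finset.prod_eq_one fun i hi => by rw [h i hi, map_one]

theorem PowerSeries.X_pow_dvd_prod_sub_prod (f : ι → F⟦X⟧) (N : ℕ) {s t : Finset ι} (hst : s ⊆ t)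
    (h : ∀ i ∈ t, i ∉ s → PowerSeries.X ^ N ∣ f i - 1) :
    PowerSeries.X ^ N ∣ (∏ i ∈ t, f i) - ∏ i ∈ s, f i := by
  classical
  rw [← Finset.prod_sdiff hst]
  have := PowerSeries.X_pow_dvd_prod_sub_one f N (t \ s) fun i hi => by
    rw [Finset.mem_sdiff] at hi
    exact h i hi.1 hi.2
  calc _ ∣ ((∏ i ∈ t \ s, f i) - 1) * ∏ i ∈ s, f i := this.mul_right _
    _ = _ := by ring

/-- A family of power series in which all but finitely many members are `1` modulo each power of
the variable has an unconditional product. -/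
theorem LaurentSeries.exists_hasProd (f : ι → F⟦X⟧)
    (h : ∀ N, {i | ¬ PowerSeries.X ^ N ∣ f i - 1}.Finite) :
    ∃ a : F⟦X⟧, HasProd (fun i => (f i : F⸨X⸩)) (a : F⸨X⸩) ∧
      ((∀ i, PowerSeries.constantCoeff (f i) = 1) → PowerSeries.constantCoeff a = 1) := by
  classical
  let s : ℕ → Finset ι := fun N => (h N).toFinset
  have hs : ∀ N (t : Finset ι), s N ⊆ t →
      PowerSeries.X ^ N ∣ (∏ i ∈ t, f i) - ∏ i ∈ s N, f i := fun N t hst =>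
    PowerSeries.X_pow_dvd_prod_sub_prod f N hst fun i _ hi => by
      by_contra hc
      exact hi ((h N).mem_toFinset.2 hc)
  let a : F⟦X⟧ := PowerSeries.mk fun m => PowerSeries.coeff m (∏ i ∈ s (m + 1), f i)
  have ha : ∀ N (t : Finset ι), s N ⊆ t → (∀ m < N, s (m + 1) ⊆ t) →
      PowerSeries.X ^ N ∣ (∏ i ∈ t, f i) - a := by
    intro N t h1 h2
    rw [PowerSeries.X_pow_dvd_iff]
    intro m hm
    have := PowerSeries.X_pow_dvd_iff.1 (hs (m + 1) t (h2 m hm)) m (Nat.lt_succ_self m)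
    rw [map_sub] at this ⊢
    rw [PowerSeries.coeff_mk]
    exact this
  refine ⟨a, ?_, fun h1 => ?_⟩
  swap
  · rw [← PowerSeries.coeff_zero_eq_constantCoeff_apply, PowerSeries.coeff_mk,
      PowerSeries.coeff_zero_eq_constantCoeff_apply, map_prod]
    exact Finset.prod_eq_one fun i _ => h1 i
  rw [HasProd, SummationFilter.unconditional_filter]
  intro S hS
  obtain ⟨γ, hγ⟩ := (Valued.mem_nhds).1 hS
  simp_rw [Valuation.restrict_lt_iff_lt_embedding] at hγ
  obtain ⟨N, hN⟩ : ∃ N : ℕ, WithZero.exp (-(N : ℤ)) <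
      MonoidWithZeroHom.ValueGroup₀.embedding γ.1 := by
    refine ⟨(-(WithZero.log (MonoidWithZeroHom.ValueGroup₀.embedding γ.1)) + 1).toNat, ?_⟩
    rw [← WithZero.lt_log_iff_exp_lt (by simp)]
    omega
  rw [Filter.mem_map, Filter.mem_atTop_sets]
  refine ⟨s N ∪ (Finset.range N).biUnion fun m => s (m + 1), fun t ht => hγ ?_⟩
  have ht1 : s N ⊆ t := Finset.subset_union_left.trans ht
  have ht2 : ∀ m < N, s (m + 1) ⊆ t := fun m hm =>
    (Finset.subset_biUnion_of_mem (fun m => s (m + 1)) (Finset.mem_range.2 hm)).trans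
      (Finset.subset_union_right.trans ht)
  have key := PowerSeries.X_pow_dvd_iff.1 (ha N t ht1 ht2)
  refine lt_of_le_of_lt ?_ hN
  beta_reduce
  rw [← map_prod, ← map_sub]
  rw [LaurentSeries.valuation_le_iff_coeff_lt_eq_zero]
  intro m hm
  rw [PowerSeries.coeff_coe]
  split_ifs with h0
  · rfl
  · exact key _ (by omega)

end InfiniteProducts

section EulerFactor

open CarlitzL

variable {F W : Type*} [Field F] [AddCommGroup W] [Module F W] {r : ℕ}

theorem eulerFactor_eq_det (b : Module.Basis (Fin r) F W) (u : F⟦X⟧) (φ : W →ₗ[F] W) :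
    eulerFactor u φ =
      ((1 : Matrix (Fin r) (Fin r) F⟦X⟧) -
        u • (LinearMap.toMatrix b b φ).map (algebraMap F F⟦X⟧)).det⁻¹ := by
  classical
  rw [eulerFactor, ← LinearMap.det_toMatrix (b.baseChange F⟦X⟧)]
  congr 2
  ext1 i j
  simp [LinearMap.toMatrix_apply, Matrix.one_apply, Finsupp.single_apply, eq_comm,
    PowerSeries.smul_eq_C_mul, mul_comm]

theorem det_one_sub_smul_sub_one_mem (I : Ideal F⟦X⟧) {u : F⟦X⟧} (hu : u ∈ I)
    (S : Matrix (Fin r) (Fin r) F⟦X⟧) : (1 - u • S).det - 1 ∈ I := by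
  rw [← Ideal.Quotient.mk_eq_mk_iff_sub_mem, RingHom.map_det, map_one, RingHom.mapMatrix_apply]
  have : (1 - u • S).map (Ideal.Quotient.mk I) = 1 := by
    ext i j
    simp [Matrix.one_apply, apply_ite (Ideal.Quotient.mk I), Ideal.Quotient.eq_zero_iff_mem.2 hu]
  rw [this, Matrix.det_one]

theorem eulerFactor_sub_one_dvd [FiniteDimensional F W] {N : ℕ} (hN : 0 < N) {u : F⟦X⟧}
    (hu : PowerSeries.X ^ N ∣ u) (φ : W →ₗ[F] W) :
    PowerSeries.X ^ N ∣ eulerFactor u φ - 1 := by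
  rw [eulerFactor_eq_det (Module.finBasis F W)]
  set S := (LinearMap.toMatrix (Module.finBasis F W) (Module.finBasis F W) φ).map
    (algebraMap F F⟦X⟧)
  have h1 : PowerSeries.X ^ N ∣ (1 - u • S).det - 1 :=
    Ideal.mem_span_singleton.1
      (det_one_sub_smul_sub_one_mem _ (Ideal.mem_span_singleton.2 hu) S)
  have h2 : PowerSeries.constantCoeff (1 - u • S).det = 1 := by
    have := PowerSeries.X_pow_dvd_iff.1 h1 0 hN
    rw [map_sub, sub_eq_zero, PowerSeries.coeff_zero_eq_constantCoeff_apply] at this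
    simpa using this
  have h3 : (1 - u • S).det * (1 - u • S).det⁻¹ = 1 :=
    PowerSeries.mul_inv_cancel _ (by rw [h2]; exact one_ne_zero)
  have h4 : (1 - u • S).det⁻¹ - 1 = -(((1 - u • S).det - 1) * (1 - u • S).det⁻¹) := by
    rw [sub_mul, h3]; ring
  rw [h4]
  exact (h1.mul_right _).neg_right

theorem constantCoeff_eq_one_of_dvd {N : ℕ} (hN : 0 < N) {f : F⟦X⟧}
    (h : PowerSeries.X ^ N ∣ f - 1) : PowerSeries.constantCoeff f = 1 := by
  have := PowerSeries.X_pow_dvd_iff.1 h 0 hN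
  rw [map_sub, sub_eq_zero, PowerSeries.coeff_zero_eq_constantCoeff_apply] at this
  simpa using this

theorem X_pow_dvd_invPoly (P : F[X]) : PowerSeries.X ^ P.natDegree ∣ invPoly P :=
  Dvd.intro _ rfl

/-- The Euler factor at `u = f⁻ⁿ` as a quotient of polynomials in `t`. -/
theorem eulerFactor_invPoly (b : Module.Basis (Fin r) F W) {f : F[X]} (hf : 0 < f.natDegree)
    {n : ℕ} (hn : 0 < n) (φ : W →ₗ[F] W) :
    (eulerFactor (invPoly f ^ n) φ : F⸨X⸩) =
      polyToLaurent (f ^ (n * r)) /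
        polyToLaurent ((f ^ n) • (1 : Matrix (Fin r) (Fin r) F[X]) -
          (LinearMap.toMatrix b b φ).map Polynomial.C).det := by
  have hf0 : f ≠ 0 := by rintro rfl; simp at hf
  have hdvd : PowerSeries.X ∣ invPoly f ^ n :=
    (dvd_pow (dvd_pow_self _ hf.ne') hn.ne').trans (pow_dvd_pow_of_dvd (X_pow_dvd_invPoly f) n)
  set S := LinearMap.toMatrix b b φ
  set D := ((1 : Matrix (Fin r) (Fin r) F⟦X⟧) - (invPoly f ^ n) • S.map (algebraMap F F⟦X⟧)).det
    with hD
  have h1 : PowerSeries.X ^ 1 ∣ D - 1 :=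
    Ideal.mem_span_singleton.1 (det_one_sub_smul_sub_one_mem _
      (Ideal.mem_span_singleton.2 (by simpa using hdvd)) _)
  have h2 : PowerSeries.constantCoeff D = 1 := constantCoeff_eq_one_of_dvd one_pos h1
  have h3 : (D : F⸨X⸩) * ((D⁻¹ : F⟦X⟧) : F⸨X⸩) = 1 := by
    rw [← map_mul, PowerSeries.mul_inv_cancel _ (by rw [h2]; exact one_ne_zero), map_one]
  have hDne : (D : F⸨X⸩) ≠ 0 := left_ne_zero_of_mul_eq_one h3
  have hp : polyToLaurent f ≠ 0 := by
    rw [Ne, map_eq_zero_iff _ polyToLaurent_injective]; exact hf0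
  have hinv : (invPoly f : F⸨X⸩) = (polyToLaurent f)⁻¹ :=
    eq_inv_of_mul_eq_one_right (polyToLaurent_mul_invPoly hf0)
  have hpolyC : ∀ c : F, polyToLaurent (Polynomial.C c) =
      HahnSeries.ofPowerSeries ℤ F (algebraMap F F⟦X⟧ c) := fun c => by
    simp [polyToLaurent]
  have key : polyToLaurent ((f ^ n) • (1 : Matrix (Fin r) (Fin r) F[X]) - S.map Polynomial.C).det =
      polyToLaurent f ^ (n * r) * (D : F⸨X⸩) := by
    rw [hD, RingHom.map_det, RingHom.map_det, RingHom.mapMatrix_apply, RingHom.mapMatrix_apply,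
      pow_mul]
    have e : ∀ (c : F⸨X⸩) (M : Matrix (Fin r) (Fin r) F⸨X⸩), c ^ r * M.det = (c • M).det :=
      fun c M => by rw [Matrix.det_smul, Fintype.card_fin]
    rw [e]
    congr 1
    ext1 i j
    by_cases hij : i = j
    · subst hij
      simp [hpolyC, hinv, mul_sub, hp]
    · simp [hpolyC, hinv, hp, hij]
  rw [eulerFactor_eq_det b, key, map_pow, eq_div_iff (mul_ne_zero (pow_ne_zero _ hp) hDne),
    mul_left_comm, mul_comm _ (D : F⸨X⸩), h3, mul_one]

theorem det_smul_one_sub_ne_zero (S : Matrix (Fin r) (Fin r) F) {f : F[X]} (hf : 0 < f.natDegree)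
    {n : ℕ} (hn : 0 < n) :
    ((f ^ n) • (1 : Matrix (Fin r) (Fin r) F[X]) - S.map Polynomial.C).det ≠ 0 := by
  intro h0
  have h := eulerFactor_invPoly (Pi.basisFun F (Fin r)) hf hn (Matrix.toLin' S)
  rw [LinearMap.toMatrix_eq_toMatrix', LinearMap.toMatrix'_toLin', h0, map_zero, div_zero] at h
  have := eulerFactor_sub_one_dvd one_pos (u := invPoly f ^ n) (by
    simpa using (dvd_pow (dvd_pow_self _ hf.ne') hn.ne').trans
      (pow_dvd_pow_of_dvd (X_pow_dvd_invPoly f) n)) (Matrix.toLin' S)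
  have h1 := constantCoeff_eq_one_of_dvd one_pos this
  rw [map_eq_zero_iff _ HahnSeries.ofPowerSeries_injective] at h
  rw [h] at h1
  simp at h1

theorem ratToLaurent_algebraMap (P : F[X]) :
    ratToLaurent (algebraMap F[X] (RatFunc F) P) = polyToLaurent P :=
  IsFractionRing.lift_algebraMap _ _

/-- The Euler factor at `u = f⁻ⁿ` is a nonzero rational function. -/
theorem exists_ratToLaurent_eq_eulerFactor [FiniteDimensional F W] {f : F[X]}
    (hf : 0 < f.natDegree) {n : ℕ} (hn : 0 < n) (φ : W →ₗ[F] W) :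
    ∃ R : (RatFunc F)ˣ, (eulerFactor (invPoly f ^ n) φ : F⸨X⸩) = ratToLaurent (R : RatFunc F) := by
  have hf0 : f ≠ 0 := by rintro rfl; simp at hf
  let b := Module.finBasis F W
  refine ⟨Units.mk0 (algebraMap F[X] (RatFunc F) (f ^ (n * Module.finrank F W)) /
    algebraMap F[X] (RatFunc F) ((f ^ n) • (1 : Matrix _ _ F[X]) -
          (LinearMap.toMatrix b b φ).map Polynomial.C).det) ?_, ?_⟩
  · refine div_ne_zero ?_ ?_
    · rw [Ne, FaithfulSMul.algebraMap_eq_zero_iff]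
      exact pow_ne_zero _ hf0
    · simpa using det_smul_one_sub_ne_zero _ hf hn
  · rw [eulerFactor_invPoly b hf hn, Units.val_mk0, map_div₀, ratToLaurent_algebraMap,
      ratToLaurent_algebraMap]

end EulerFactor

/-! ### Conjugates and Frobenius twists over finite fields -/

section FrobeniusConjugates

open Module

variable {k E l : Type*} [Field k] [Fintype k] [Field E] [Algebra k E] [Field l] [Algebra k l]

/-- The `i`-th Frobenius twist of a homomorphism `j` of `k`-algebras. -/
def frobTwist {A : Type*} [CommRing A] [Algebra k A] (j : A →ₐ[k] E) (i : ℕ) : A →ₐ[k] E :=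
  j.comp (FiniteField.frobeniusAlgHom k A ^ i)

theorem frobTwist_apply {A : Type*} [CommRing A] [Algebra k A] (j : A →ₐ[k] E) (i : ℕ) (x : A) :
    frobTwist j i x = j x ^ Fintype.card k ^ i := by
  rw [frobTwist, AlgHom.comp_apply, AlgHom.coe_pow, FiniteField.coe_frobeniusAlgHom, pow_iterate,
    map_pow]

variable [FiniteDimensional k l] (j : l →ₐ[k] E)

/-- The Frobenius twists of an embedding of a finite field are linearly independent. -/
theorem linearIndependent_frobTwist :
    LinearIndependent E (fun (i : Fin (finrank k l)) => (frobTwist j i : l → E)) := by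
  have : Finite l := Module.finite_of_finite k
  refine (linearIndependent_monoidHom l E).comp
    (fun i : Fin (finrank k l) => ((frobTwist j i : l →ₐ[k] E) : l →* E)) fun i i' h => ?_
  refine (FiniteField.bijective_frobeniusAlgHom_pow k l).1 (AlgHom.ext fun x => ?_)
  exact j.injective (DFunLike.congr_fun h x)

/-- The matrix of the Frobenius conjugates of the members of a basis of a finite field. -/
def conjMatrix (b : Basis (Fin (finrank k l)) k l) :
    Matrix (Fin (finrank k l)) (Fin (finrank k l)) E :=
  Matrix.of fun i m => frobTwist j i (b m)

theorem conjMatrix_isUnit (b : Basis (Fin (finrank k l)) k l) :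
    IsUnit (conjMatrix j b) := by
  rw [← Matrix.linearIndependent_rows_iff_isUnit, Fintype.linearIndependent_iff]
  intro g hg
  refine Fintype.linearIndependent_iff.1 (linearIndependent_frobTwist j) g ?_
  funext x
  have hx : ∀ m, ∑ i, g i * frobTwist j i (b m) = 0 := fun m => by
    simpa [conjMatrix, Matrix.row] using congrFun hg m
  rw [Finset.sum_apply]
  simp only [Pi.smul_apply, smul_eq_mul, Pi.zero_apply]
  have h0 : (∑ i, (g i) • (frobTwist j i).toLinearMap : l →ₗ[k] E) = 0 := by
    refine b.ext fun m => ?_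
    simpa [LinearMap.sum_apply] using hx m
  simpa [LinearMap.sum_apply] using LinearMap.congr_fun h0 x

/-- The conjugates of a basis have a dual family that isolates the twist `i₀`. -/
theorem exists_dual_conj (b : Basis (Fin (finrank k l)) k l) (i₀ : Fin (finrank k l)) :
    ∃ c : Fin (finrank k l) → E,
      ∀ i : Fin (finrank k l), ∑ m, c m * frobTwist j i (b m) = if i = i₀ then 1 else 0 := by
  refine ⟨fun m => (conjMatrix j b)⁻¹ m i₀, fun i => ?_⟩
  have := congrFun (congrFun (Matrix.mul_nonsing_inv (conjMatrix j b)
    ((Matrix.isUnit_iff_isUnit_det _).1 (conjMatrix_isUnit j b))) i) i₀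
  rw [Matrix.mul_apply, Matrix.one_apply] at this
  rw [← this]
  refine Finset.sum_congr rfl fun m _ => ?_
  rw [mul_comm]
  rfl

theorem eq_zero_of_sum_conj_eq_zero (b : Basis (Fin (finrank k l)) k l)
    (x : Fin (finrank k l) → E)
    (h : ∀ i : Fin (finrank k l), ∑ m, x m * frobTwist j i (b m) = 0) : x = 0 := by
  refine Matrix.mulVec_injective_of_isUnit (conjMatrix_isUnit j b) ?_
  rw [Matrix.mulVec_zero]
  funext i
  rw [Pi.zero_apply, ← h i]
  simp only [Matrix.mulVec, dotProduct, conjMatrix, Matrix.of_apply, mul_comm]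

/-- The characteristic polynomial of multiplication by an element of a finite field has the
Frobenius conjugates of that element as its roots. -/
theorem map_charpoly_mulLeft (z : l) :
    (LinearMap.mulLeft k z).charpoly.map (algebraMap k E) =
      ∏ i ∈ Finset.range (finrank k l),
        (Polynomial.X - Polynomial.C (j z ^ Fintype.card k ^ i)) := by
  classical
  let b := Module.finBasis k l
  have hA := conjMatrix_isUnit j b
  have hdet := (Matrix.isUnit_iff_isUnit_det _).1 hA
  let D : Matrix (Fin (finrank k l)) (Fin (finrank k l)) E :=
    Matrix.diagonal fun i => frobTwist j i z
  have h : conjMatrix j b * (LinearMap.toMatrix b b (LinearMap.mulLeft k z)).map (algebraMap k E) =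
      D * conjMatrix j b := by
    ext i m
    rw [Matrix.diagonal_mul, Matrix.mul_apply]
    simp only [conjMatrix, Matrix.of_apply, Matrix.map_apply, LinearMap.toMatrix_apply,
      LinearMap.mulLeft_apply]
    rw [← map_mul]
    conv_rhs => rw [← b.sum_repr (z * b m), map_sum]
    refine Finset.sum_congr rfl fun s _ => ?_
    rw [map_smul, Algebra.smul_def, mul_comm]
  have h2 : (LinearMap.toMatrix b b (LinearMap.mulLeft k z)).map (algebraMap k E) =
      (conjMatrix j b)⁻¹ * (D * conjMatrix j b) := by
    rw [← h, Matrix.nonsing_inv_mul_cancel_left _ _ hdet]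
  rw [← LinearMap.charpoly_toMatrix _ b, ← Matrix.charpoly_map, h2, Matrix.charpoly_mul_comm,
    Matrix.mul_assoc, Matrix.mul_nonsing_inv _ hdet, Matrix.mul_one, Matrix.charpoly_diagonal,
    ← Fin.prod_univ_eq_prod_range fun i =>
      (Polynomial.X - Polynomial.C (j z ^ Fintype.card k ^ i))]
  simp only [frobTwist_apply]

end FrobeniusConjugates

section TraceLinearization

open Module

variable {k F E W : Type*} [Field k] [Field F] [Algebra k F] [FiniteDimensional k F]
  [Algebra.IsSeparable k F]
  [Field E] [Algebra k E] [Algebra F E] [IsScalarTower k F E] [AddCommGroup W] [Module k W]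
  [Module F W] [IsScalarTower k F W]

theorem sum_trace_smul_traceDual {ι : Type*} [Fintype ι] [DecidableEq ι] (b : Basis ι k F) (x : F) :
    ∑ a, Algebra.trace k F (x * b a) • b.traceDual a = x := by
  have := b.traceDual.sum_repr x
  simpa only [Basis.traceDual_repr_apply, Algebra.traceForm_apply] using this

theorem sum_trace_traceDual_smul {ι : Type*} [Fintype ι] [DecidableEq ι] (b : Basis ι k F) (x : F) :
    ∑ a, Algebra.trace k F (x * b.traceDual a) • b a = x := by
  have := sum_trace_smul_traceDual b.traceDual x
  rwa [Basis.traceDual_traceDual] at this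

/-- The `F`-linear map attached to a `k`-linear map `f : W → E`. It is the component of `f` in
`Hom_F(W, E)` for the decomposition of `Hom_k(W, E)` along the embeddings of `F` in `E`, computed
with a basis of `F` over `k` and its dual basis for the trace form. -/
def fLinearPart (f : W →ₗ[k] E) : W →ₗ[F] E where
  toFun w := ∑ a, algebraMap F E ((finBasis k F).traceDual a) * f (finBasis k F a • w)
  map_add' w w' := by simp [mul_add, Finset.sum_add_distrib]
  map_smul' c w := by
    let e := finBasis k F
    have h : ∀ a, e a • c • w = ∑ a', Algebra.trace k F (e a * c * e.traceDual a') • e a' • w := by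
      intro a
      conv_lhs => rw [smul_smul, ← sum_trace_traceDual_smul e (e a * c), Finset.sum_smul]
      simp only [smul_assoc]
    have h2 : ∀ a', c * e.traceDual a' =
        ∑ a, Algebra.trace k F (e a * c * e.traceDual a') • e.traceDual a := by
      intro a'
      conv_lhs => rw [← sum_trace_smul_traceDual e (c * e.traceDual a')]
      exact Finset.sum_congr rfl fun a _ => by rw [mul_comm, mul_assoc]
    change ∑ a, algebraMap F E (e.traceDual a) * f (e a • c • w) =
      c • ∑ a, algebraMap F E (e.traceDual a) * f (e a • w)
    simp only [h, map_sum, LinearMap.map_smul, Finset.mul_sum]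
    rw [Finset.sum_comm, Finset.smul_sum]
    refine Finset.sum_congr rfl fun a' _ => ?_
    rw [Algebra.smul_def, ← mul_assoc, ← map_mul, h2, map_sum, Finset.sum_mul]
    refine Finset.sum_congr rfl fun a _ => ?_
    rw [Algebra.smul_def, Algebra.smul_def, map_mul (algebraMap F E),
      ← IsScalarTower.algebraMap_apply]
    ring

theorem fLinearPart_apply (f : W →ₗ[k] E) (w : W) :
    fLinearPart (F := F) f w =
      ∑ a, algebraMap F E ((finBasis k F).traceDual a) * f (finBasis k F a • w) := rfl

theorem fLinearPart_add (f f' : W →ₗ[k] E) :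
    fLinearPart (F := F) (f + f') = fLinearPart f + fLinearPart f' := by
  ext w
  simp [fLinearPart_apply, mul_add, Finset.sum_add_distrib]

theorem fLinearPart_sum {ι : Type*} (s : Finset ι) (f : ι → W →ₗ[k] E) :
    fLinearPart (F := F) (∑ i ∈ s, f i) = ∑ i ∈ s, fLinearPart (f i) :=
  map_sum (⟨⟨fLinearPart (F := F), by ext; simp [fLinearPart_apply]⟩, fLinearPart_add⟩ :
    (W →ₗ[k] E) →+ (W →ₗ[F] E)) _ _

theorem fLinearPart_comp {W' : Type*} [AddCommGroup W'] [Module k W']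
    [Module F W'] [IsScalarTower k F W'] (f : W →ₗ[k] E) (S : W' →ₗ[F] W) (w : W') :
    fLinearPart (F := F) (f ∘ₗ S.restrictScalars k) w = fLinearPart (F := F) f (S w) := by
  simp [fLinearPart_apply]

theorem fLinearPart_lsmul (f : W →ₗ[k] E) (c : F) :
    fLinearPart (F := F) (f ∘ₗ (LinearMap.lsmul F W c).restrictScalars k) = c • fLinearPart f := by
  ext w
  rw [fLinearPart_comp]
  simp

theorem fLinearPart_mulLeft (f : W →ₗ[k] E) (c : E) (w : W) :
    fLinearPart (F := F) (LinearMap.mulLeft k c ∘ₗ f) w = c * fLinearPart (F := F) f w := by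
  simp only [fLinearPart_apply, Finset.mul_sum, LinearMap.comp_apply, LinearMap.mulLeft_apply]
  exact Finset.sum_congr rfl fun a _ => by ring

theorem fLinearPart_trace (x : W →ₗ[F] F) (c : E) (w : W) :
    fLinearPart (F := F) ((LinearMap.toSpanSingleton k E c) ∘ₗ
      ((Algebra.trace k F) ∘ₗ x.restrictScalars k)) w = algebraMap F E (x w) * c := by
  rw [fLinearPart_apply]
  simp only [LinearMap.comp_apply, LinearMap.restrictScalars_apply, LinearMap.map_smul,
    LinearMap.toSpanSingleton_apply, smul_eq_mul]
  conv_rhs => rw [← sum_trace_smul_traceDual (finBasis k F) (x w), map_sum, Finset.sum_mul]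
  refine Finset.sum_congr rfl fun a _ => ?_
  rw [Algebra.smul_def, Algebra.smul_def, map_mul (algebraMap F E),
    ← IsScalarTower.algebraMap_apply, mul_comm (x w)]
  ring

/-- The `F`-linear parts of all Frobenius twists of `k`-linear maps `f m : W → l` to a finite field
determine these maps, also after extending scalars: if a combination of them with coefficients
`c m` in `E` vanishes, then so does `∑ π (c m) • f m` for every `F`-linear `π : E → F`. -/
theorem sum_eq_zero_of_fLinearPart_frobTwist [Fintype k] {l : Type*} [Field l] [Algebra k l]
    [FiniteDimensional k l] (j : l →ₐ[k] E) {h : ℕ} (f : Fin h → W →ₗ[k] l) (c : Fin h → E)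
    (hc : ∀ i < finrank k l, ∀ w,
      ∑ m, c m * fLinearPart (F := F) ((frobTwist j i).toLinearMap ∘ₗ f m) w = 0)
    (π : E →ₗ[F] F) (w : W) : ∑ m, f m (π (c m) • w) = 0 := by
  let b := finBasis k l
  let e := finBasis k F
  -- the components of `f m` in the basis `b` of `l`, made `F`-linear
  let X : Fin h → Fin (finrank k l) → W → F := fun m s w =>
    ∑ a, e.traceDual a * algebraMap k F (b.repr (f m (e a • w)) s)
  have h1 : ∀ i m w, fLinearPart (F := F) ((frobTwist j i).toLinearMap ∘ₗ f m) w =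
      ∑ s, algebraMap F E (X m s w) * frobTwist j i (b s) := by
    intro i m w
    rw [fLinearPart_apply]
    simp only [X, map_sum, Finset.sum_mul]
    rw [Finset.sum_comm]
    refine Finset.sum_congr rfl fun a _ => ?_
    rw [LinearMap.comp_apply]
    conv_lhs => rw [← b.sum_repr (f m (e a • w)), map_sum, Finset.mul_sum]
    refine Finset.sum_congr rfl fun s _ => ?_
    rw [map_smul, Algebra.smul_def, map_mul (algebraMap F E),
      ← IsScalarTower.algebraMap_apply, mul_assoc]
    rfl
  have h2 : ∀ w s, ∑ m, c m * algebraMap F E (X m s w) = 0 := by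
    intro w
    refine congrFun (eq_zero_of_sum_conj_eq_zero j b
      (fun s => ∑ m, c m * algebraMap F E (X m s w)) fun i => ?_)
    rw [← hc i i.isLt w]
    simp only [Finset.sum_mul, h1, Finset.mul_sum]
    rw [Finset.sum_comm]
    exact Finset.sum_congr rfl fun m _ => Finset.sum_congr rfl fun s _ => by ring
  have h3 : ∀ w s, ∑ m, π (c m) * X m s w = 0 := by
    intro w s
    have := congrArg π (h2 w s)
    rw [map_sum, map_zero] at this
    rw [← this]
    refine Finset.sum_congr rfl fun m _ => ?_
    rw [mul_comm (c m), ← Algebra.smul_def, map_smul, smul_eq_mul, mul_comm]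
  have hX : ∀ m s (c : F) w, X m s (c • w) = c * X m s w := by
    intro m s c w
    have := (fLinearPart (F := F) (E := F)
      ((Algebra.linearMap k F) ∘ₗ (b.coord s) ∘ₗ f m)).map_smul c w
    rw [fLinearPart_apply, fLinearPart_apply] at this
    exact this
  have h4 : ∀ w s a, b.repr (∑ m, f m (e a • π (c m) • w)) s = 0 := by
    intro w s
    have h5 : ∑ a, b.repr (∑ m, f m (e a • π (c m) • w)) s • e.traceDual a = 0 := by
      rw [← h3 w s]
      simp only [← hX, X]
      rw [Finset.sum_comm]
      refine Finset.sum_congr rfl fun a _ => ?_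
      rw [map_sum, Finsupp.finsetSum_apply, Finset.sum_smul]
      refine Finset.sum_congr rfl fun m _ => ?_
      rw [Algebra.smul_def, mul_comm]
    exact Fintype.linearIndependent_iff.1 e.traceDual.linearIndependent _ h5
  have h6 : ∀ w a, ∑ m, f m (e a • π (c m) • w) = 0 := fun w a => by
    refine b.repr.map_eq_zero_iff.1 (Finsupp.ext fun s => ?_)
    exact h4 w s a
  have hd : 0 < finrank k F := finrank_pos
  have he : e ⟨0, hd⟩ ≠ 0 := e.ne_zero _
  have := h6 ((e ⟨0, hd⟩)⁻¹ • w) ⟨0, hd⟩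
  rw [← this]
  refine Finset.sum_congr rfl fun m _ => ?_
  rw [smul_smul, smul_smul]
  congr 2
  field_simp

end TraceLinearization

/-! ### Galois actions, and the arithmetic of `O_K` and `O_L` -/

section GaloisAction

variable {S G : Type*} [CommRing S] [Group G] [MulSemiringAction G S]

theorem MulSemiringAction.coeff_charpoly_mem [Fintype G] (P : Ideal S) (x : S)
    (hx : ∀ g : G, g • x ∈ P) {i : ℕ} (hi : i < Fintype.card G) :
    (MulSemiringAction.charpoly G x).coeff i ∈ P := by
  have hmap : (MulSemiringAction.charpoly G x).map (Ideal.Quotient.mk P) =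
      Polynomial.X ^ Fintype.card G := by
    rw [MulSemiringAction.charpoly_eq, Polynomial.map_prod]
    simp [Ideal.Quotient.eq_zero_iff_mem.2 (hx _)]
  rw [← Ideal.Quotient.eq_zero_iff_mem, ← Polynomial.coeff_map, hmap, Polynomial.coeff_X_pow,
    if_neg hi.ne]

/-- An element all of whose conjugates lie in `P` is nilpotent modulo `𝔭 S`: all coefficients but
the first of the polynomial with these conjugates as roots lie in `𝔭`. -/
theorem pow_card_mem_map_of_smul_mem [Fintype G] {R : Type*} [CommRing R] (φ : R →+* S)
    (hφ : ∀ x : S, (∀ g : G, g • x = x) → ∃ y, φ y = x) (P : Ideal S) (x : S)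
    (hx : ∀ g : G, g • x ∈ P) : x ^ Fintype.card G ∈ (P.comap φ).map φ := by
  nontriviality S
  let c := MulSemiringAction.charpoly G x
  have hmonic : c.Monic := MulSemiringAction.monic_charpoly _ _
  have hdeg : c.natDegree = Fintype.card G := by
    rw [show c = _ from MulSemiringAction.charpoly_eq _ _,
      Polynomial.natDegree_prod_of_monic _ _ fun g _ => Polynomial.monic_X_sub_C _]
    simp
  have hcoeff : ∀ i < Fintype.card G, c.coeff i ∈ (P.comap φ).map φ := by
    intro i hi
    obtain ⟨y, hy⟩ := hφ (c.coeff i) fun g => MulSemiringAction.smul_coeff_charpoly _ _ _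
    rw [← hy]
    refine Ideal.mem_map_of_mem _ ?_
    rw [Ideal.mem_comap, hy]
    exact MulSemiringAction.coeff_charpoly_mem P x hx hi
  have heval : c.eval x = 0 := MulSemiringAction.eval_charpoly _ _
  rw [hmonic.as_sum, Polynomial.eval_add, Polynomial.eval_pow, Polynomial.eval_X,
    Polynomial.eval_finsetSum, hdeg] at heval
  rw [eq_neg_of_add_eq_zero_left heval]
  refine neg_mem (Ideal.sum_mem _ fun i hi => ?_)
  rw [Polynomial.eval_mul, Polynomial.eval_C]
  exact Ideal.mul_mem_right _ _ (hcoeff i (Finset.mem_range.1 hi))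

/-- The Chinese remainder theorem for the conjugates of a maximal ideal `P`: a family of residues
modulo `P`, indexed by `g` and compatible with the action of the stabilizer of `P`, comes from the
conjugates `g • x` of one element `x`. -/
theorem exists_forall_mk_smul_eq [Finite G] (P : Ideal S) [hP : P.IsMaximal] (y : G → S ⧸ P)
    (hy : ∀ γ ∈ MulAction.stabilizer G P, ∀ g, ∀ b : S, Ideal.Quotient.mk P b = y g →
      Ideal.Quotient.mk P (γ • b) = y (γ * g)) :
    ∃ x : S, ∀ g : G, Ideal.Quotient.mk P (g • x) = y g := by
  let Q : MulAction.orbit G P → Ideal S := fun Q => Q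
  choose h hh using fun Q : MulAction.orbit G P => Q.2
  simp only at hh
  have hmax : ∀ R, (Q R).IsMaximal := fun R => by
    have := hh R
    change h R • P = Q R at this
    rw [← this]
    exact Ideal.map_isMaximal_of_equiv (MulSemiringAction.toRingEquiv G S (h R))
  choose a ha using fun g => Ideal.Quotient.mk_surjective (y g)
  have : Finite (MulAction.orbit G P) := Set.finite_range fun g : G => g • P
  have hcop : Pairwise (Function.onFun IsCoprime Q) := fun R R' hne => by
    have := hmax R
    have := hmax R'
    exact Ideal.isCoprime_of_isMaximal fun e => hne (Subtype.ext e)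
  obtain ⟨x, hx⟩ := Ideal.exists_forall_sub_mem_ideal hcop fun R => h R • a (h R)⁻¹
  refine ⟨x, fun g => ?_⟩
  let R : MulAction.orbit G P := ⟨g⁻¹ • P, ⟨g⁻¹, rfl⟩⟩
  have h1 : h R • P = g⁻¹ • P := hh R
  have h2 : g * h R ∈ MulAction.stabilizer G P := by
    rw [MulAction.mem_stabilizer_iff, mul_smul, h1, smul_inv_smul]
  have h3 : g • (x - h R • a (h R)⁻¹) ∈ P := by
    have : x - h R • a (h R)⁻¹ ∈ g⁻¹ • P := hx R
    rwa [Ideal.mem_inv_pointwise_smul_iff] at this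
  have h4 := hy _ h2 (h R)⁻¹ _ (ha (h R)⁻¹)
  rw [mul_inv_cancel_right] at h4
  rw [← h4, ← sub_eq_zero, ← map_sub, Ideal.Quotient.eq_zero_iff_mem, mul_smul, ← smul_sub]
  exact h3

/-- Over a finite residue field, every element of the decomposition group acts on the residue field
of `P` as a power of Frobenius. -/
theorem exists_pow_of_mem_stabilizer {R : Type*} [CommRing R] (φ : R →+* S)
    (hφ : ∀ (g : G) (r : R), g • φ r = φ r) (P : Ideal S) [hP : P.IsMaximal]
    [Finite (S ⧸ P)] (hp : (P.comap φ).IsMaximal) (γ : G) (hγ : γ ∈ MulAction.stabilizer G P) :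
    ∃ i : ℕ, ∀ x : S, Ideal.Quotient.mk P (γ • x) =
      Ideal.Quotient.mk P x ^ Nat.card (R ⧸ P.comap φ) ^ i := by
  let _ : Field (S ⧸ P) := Ideal.Quotient.field P
  let _ : Field (R ⧸ P.comap φ) := Ideal.Quotient.field _
  let _ : Algebra (R ⧸ P.comap φ) (S ⧸ P) := (Ideal.quotientMap P φ le_rfl).toAlgebra
  have hfin : Finite (R ⧸ P.comap φ) :=
    Finite.of_injective _ (FaithfulSMul.algebraMap_injective (R ⧸ P.comap φ) (S ⧸ P))
  let _ := Fintype.ofFinite (R ⧸ P.comap φ)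
  have hle : P ≤ P.comap (MulSemiringAction.toRingHom G S γ) := fun x hx => by
    rw [Ideal.mem_comap]
    have := Ideal.smul_mem_pointwise_smul γ x P hx
    rwa [MulAction.mem_stabilizer_iff.1 hγ] at this
  let f : (S ⧸ P) →ₐ[R ⧸ P.comap φ] (S ⧸ P) :=
    { Ideal.quotientMap P (MulSemiringAction.toRingHom G S γ) hle with
      commutes' := fun r => by
        obtain ⟨r, rfl⟩ := Ideal.Quotient.mk_surjective r
        exact congrArg (Ideal.Quotient.mk P) (hφ γ r) }
  obtain ⟨i, hi⟩ := (FiniteField.bijective_frobeniusAlgHom_pow (R ⧸ P.comap φ) (S ⧸ P)).2 f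
  refine ⟨i, fun x => ?_⟩
  have := DFunLike.congr_fun hi (Ideal.Quotient.mk P x)
  simp only [AlgHom.coe_pow, FiniteField.coe_frobeniusAlgHom, pow_iterate] at this
  rw [Nat.card_eq_fintype_card, this]
  rfl

end GaloisAction

section FunctionFieldArithmetic

open CarlitzL

theorem RingHom.Finite.of_comp_injective {A B C : Type*} [CommRing A] [CommRing B] [CommRing C]
    [IsNoetherianRing A] (g : A →+* B) (h : B →+* C) (hh : Function.Injective h)
    (hf : (h.comp g).Finite) : g.Finite := by
  let _ := g.toAlgebra
  let _ := h.toAlgebra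
  let _ := (h.comp g).toAlgebra
  have : IsScalarTower A B C := IsScalarTower.of_algebraMap_eq' rfl
  have : Module.Finite A C := hf
  exact Module.Finite.of_injective (IsScalarTower.toAlgHom A B C).toLinearMap hh

theorem Polynomial.finite_iterateFrobenius (k : Type*) [Field k] [Finite k] (p : ℕ) [ExpChar k p]
    (e : ℕ) : (iterateFrobenius k[X] p e).Finite := by
  have hpos : 0 < p ^ e := pow_pos (expChar_pos k p) e
  refine RingHom.IsIntegral.to_finite (fun P => ?_) ?_
  · refine ⟨Polynomial.X ^ p ^ e - Polynomial.C P, Polynomial.monic_X_pow_sub_C P hpos.ne', ?_⟩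
    simp [iterateFrobenius_def]
  · have h : ((iterateFrobenius k[X] p e).comp Polynomial.C) =
        (Polynomial.C : k →+* k[X]).comp (iterateFrobenius k p e) := by
      ext x
      simp [iterateFrobenius_def]
    refine RingHom.FiniteType.of_comp_finiteType (f := Polynomial.C) ?_
    rw [h]
    refine RingHom.FiniteType.comp ?_ ?_
    · exact RingHom.finiteType_algebraMap.2 (inferInstanceAs (Algebra.FiniteType k k[X]))
    · exact RingHom.FiniteType.of_surjective _ (bijective_iterateFrobenius k p e).2

/-- The integral closure of `k[t]` in a finite extension `K` of `k(t)` is a finite `k[t]`-module. In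
the inseparable case it is embedded by a power of Frobenius in the integral closure in the maximal
separable subextension, and `k[t]` is finite over the image of that power. -/
theorem finite_integralClosure (k K : Type*) [Field k] [Finite k] [Field K] [Algebra k[X] K]
    [Algebra (RatFunc k) K] [IsScalarTower k[X] (RatFunc k) K] [FiniteDimensional (RatFunc k) K] :
    Module.Finite k[X] (integralClosure k[X] K) := by
  obtain ⟨p, hp⟩ := ExpChar.exists k
  have : ExpChar (RatFunc k) p :=
    expChar_of_injective_algebraMap (FaithfulSMul.algebraMap_injective k (RatFunc k)) p
  have : ExpChar K p :=
    expChar_of_injective_algebraMap (FaithfulSMul.algebraMap_injective (RatFunc k) K) p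
  let S := separableClosure (RatFunc k) K
  let e := IsPurelyInseparable.exponent S K
  have : ExpChar S p :=
    expChar_of_injective_algebraMap (FaithfulSMul.algebraMap_injective (RatFunc k) S) p
  have hpow : ∀ x : K, x ^ p ^ e ∈ S := fun x => by
    obtain ⟨y, hy⟩ := IsPurelyInseparable.exponent_def' S p x
    rw [← hy]
    exact y.2
  have : IsScalarTower k[X] S K := IsScalarTower.of_algebraMap_eq fun _ => rfl
  have hfinS : Module.Finite k[X] (integralClosure k[X] S) :=
    IsIntegralClosure.finite k[X] (RatFunc k) S _
  let h₀ : integralClosure k[X] K →+* S :=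
    ((iterateFrobenius K p e).comp (integralClosure k[X] K).val.toRingHom).codRestrict S
      fun x => hpow x
  have h₀_coe : ∀ x, ((h₀ x : S) : K) = (x : K) ^ p ^ e := fun x => rfl
  let h : integralClosure k[X] K →+* integralClosure k[X] S :=
    h₀.codRestrict (integralClosure k[X] S) fun x => by
      refine (isIntegral_algebraMap_iff (B := K) (FaithfulSMul.algebraMap_injective S K)).1 ?_
      change IsIntegral k[X] ((x : K) ^ p ^ e)
      exact IsIntegral.pow x.2 _
  have hh : Function.Injective h := by
    intro x y hxy
    have h1 : (x : K) ^ p ^ e = (y : K) ^ p ^ e := by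
      rw [← h₀_coe, ← h₀_coe]
      exact congrArg (fun z : integralClosure k[X] S => ((z : S) : K)) hxy
    exact Subtype.ext (iterateFrobenius_inj K p e h1)
  have hcomp : h.comp (algebraMap k[X] (integralClosure k[X] K)) =
      (algebraMap k[X] (integralClosure k[X] S)).comp (iterateFrobenius k[X] p e) := by
    refine RingHom.ext fun P => Subtype.ext (Subtype.ext ?_)
    change (algebraMap k[X] K P) ^ p ^ e = algebraMap k[X] K (iterateFrobenius k[X] p e P)
    rw [iterateFrobenius_def, map_pow]
  have := RingHom.Finite.of_comp_injective (algebraMap k[X] (integralClosure k[X] K)) h hh (by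
    rw [hcomp]
    exact RingHom.Finite.comp (RingHom.finite_algebraMap.2 hfinS)
      (Polynomial.finite_iterateFrobenius k p e))
  exact RingHom.finite_algebraMap.1 this

instance Polynomial.hasFiniteQuotients (k : Type*) [Field k] [Finite k] :
    Ring.HasFiniteQuotients k[X] where
  finiteQuotient {I} hI := by
    obtain ⟨P, rfl⟩ := Submodule.IsPrincipal.principal I
    have hP : P ≠ 0 := fun h => hI (by simp [h])
    have : Module.Finite k (AdjoinRoot P) := (AdjoinRoot.powerBasis hP).finite
    exact Module.finite_of_finite k (M := AdjoinRoot P)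

theorem hasFiniteQuotients_OInt (k K : Type*) [Field k] [Finite k] [Field K] [Algebra k[X] K]
    [Algebra (RatFunc k) K] [IsScalarTower k[X] (RatFunc k) K] [FiniteDimensional (RatFunc k) K] :
    Ring.HasFiniteQuotients (OInt k K) := by
  have := finite_integralClosure k K
  exact Ring.HasFiniteQuotients.of_module_finite k[X] _

theorem OInt_isMaximal_ne_bot {k K : Type*} [Field k] [Field K] [Algebra k[X] K]
    [Algebra (RatFunc k) K] [IsScalarTower k[X] (RatFunc k) K]
    (𝔭 : Ideal (OInt k K)) [h𝔭 : 𝔭.IsMaximal] : 𝔭 ≠ ⊥ := by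
  rintro rfl
  have hinj : Function.Injective (algebraMap k[X] K) := by
    rw [IsScalarTower.algebraMap_eq k[X] (RatFunc k) K]
    exact (FaithfulSMul.algebraMap_injective (RatFunc k) K).comp
      (FaithfulSMul.algebraMap_injective k[X] (RatFunc k))
  have hinj' : Function.Injective (algebraMap k[X] (OInt k K)) := fun x y hxy =>
    hinj (congrArg Subtype.val hxy)
  have hO : IsField (OInt k K) := Ring.isField_iff_maximal_bot.2 h𝔭
  exact Polynomial.not_isField k (isField_of_isIntegral_of_isField hinj' hO)

variable {k K L : Type*} [Field k] [Field K] [Algebra k[X] K] [Field L] [Algebra K L]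
  [Algebra k[X] L] [IsScalarTower k[X] K L]

theorem smul_inclO (g : Gal(L/K)) (x : OInt k K) : g • inclO k K L x = inclO k K L x :=
  Subtype.ext (g.commutes (x : K))

variable [FiniteDimensional K L] [IsGalois K L]

theorem exists_inclO_eq (x : OInt k L) (hx : ∀ g : Gal(L/K), g • x = x) :
    ∃ y : OInt k K, inclO k K L y = x := by
  obtain ⟨y, hy⟩ := (IsGalois.mem_range_algebraMap_iff_fixed (F := K) (x : L)).2
    fun g => congrArg Subtype.val (hx g)
  have hint : IsIntegral k[X] y := by
    refine (isIntegral_algebraMap_iff (B := L) (FaithfulSMul.algebraMap_injective K L)).1 ?_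
    rw [hy]
    exact x.2
  exact ⟨⟨y, hint⟩, Subtype.ext hy⟩

theorem hasFiniteQuotients_OInt_of_tower (k K L : Type*) [Field k] [Field K] [Algebra k[X] K]
    [Algebra (RatFunc k) K] [IsScalarTower k[X] (RatFunc k) K] [FiniteDimensional (RatFunc k) K]
    [Field L] [Algebra K L] [FiniteDimensional K L] [Algebra k[X] L] [IsScalarTower k[X] K L]
    [Finite k] : Ring.HasFiniteQuotients (OInt k L) := by
  let _ : Algebra (RatFunc k) L := ((algebraMap K L).comp (algebraMap (RatFunc k) K)).toAlgebra
  have : IsScalarTower (RatFunc k) K L := IsScalarTower.of_algebraMap_eq' rfl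
  have : IsScalarTower k[X] (RatFunc k) L := IsScalarTower.of_algebraMap_eq fun P => by
    rw [IsScalarTower.algebraMap_apply k[X] K L, IsScalarTower.algebraMap_apply k[X] (RatFunc k) K]
    rfl
  have : FiniteDimensional (RatFunc k) L := FiniteDimensional.trans (RatFunc k) K L
  exact hasFiniteQuotients_OInt k L

end FunctionFieldArithmetic

/-! ### The description of `Hom_{k[G]}(V, Bⁿ)` by Frobenius twists -/

section LocalFactor

open CarlitzL Module

variable {k F G V B l E : Type*} [Field k] [Fintype k] [Field F] [Algebra k F]
  [FiniteDimensional k F] [Group G] [AddCommGroup V] [Module k V] [Module F V]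
  [IsScalarTower k F V] {ρ : Representation F G V}
  [CommRing B] [Algebra k B] [Algebra k[X] B] [IsScalarTower k k[X] B]
  {α : G →* (B →ₐ[k[X]] B)} [Field l] [Algebra k l] [FiniteDimensional k l] {pr : B →ₐ[k] l}
  [Field E] [Algebra k E] [Algebra F E] [IsScalarTower k F E] {j : l →ₐ[k] E}

instance : Algebra.IsSeparable k F := Algebra.IsAlgebraic.isSeparable_of_perfectField

/-- The properties of the reduction map `pr : B → l` from `B = O_L / 𝔭 O_L` to the residue field of
a prime `𝔓` above `𝔭` that enter in the computation of the local factors. Here `D` is the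
decomposition group, `I` the inertia group, `σ` a lift of Frobenius and `d` the residue degree
of `𝔭` over `k`. The conjugates of `pr` are the reductions modulo the other primes above `𝔭`, so
that `isNilpotent` says that the intersection of these primes is nilpotent in `B`, and `exists_lift`
is the Chinese remainder theorem for them. -/
structure IsReduction (α : G →* (B →ₐ[k[X]] B)) (pr : B →ₐ[k] l) (D : Subgroup G) (I : Subgroup D)
    (σ : D) (d : ℕ) : Prop where
  isNilpotent : ∀ b, (∀ g, pr (α g b) = 0) → IsNilpotent b
  exists_lift : ∀ y : G → l,
    (∀ γ ∈ D, ∀ g, ∀ b, pr b = y g → pr (α γ b) = y (γ * g)) → ∃ b, ∀ g, pr (α g b) = y g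
  mem_inertia : ∀ γ : D, γ ∈ I ↔ ∀ b, pr (α γ b) = pr b
  frob : ∀ b, pr (α σ b) = pr b ^ Fintype.card k ^ d
  exists_pow : ∀ γ ∈ D, ∃ i : ℕ, ∀ b, pr (α γ b) = pr b ^ (Fintype.card k ^ d) ^ i
  pos : 0 < d
  dvd : d ∣ finrank k l

/-- The `F`-linear part of the `i`-th Frobenius twist of a `k`-linear map `V → l`. -/
def twistPart (j : l →ₐ[k] E) (f : V →ₗ[k] l) (i : ℕ) : V →ₗ[F] E :=
  fLinearPart ((frobTwist j i).toLinearMap ∘ₗ f)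

omit [FiniteDimensional k l] in
theorem twistPart_add (f f' : V →ₗ[k] l) (i : ℕ) :
    twistPart (F := F) j (f + f') i = twistPart j f i + twistPart j f' i := by
  rw [twistPart, LinearMap.comp_add, fLinearPart_add]; rfl

omit [FiniteDimensional k l] in
theorem twistPart_zero (i : ℕ) : twistPart (F := F) j (0 : V →ₗ[k] l) i = 0 := by
  have := twistPart_add (F := F) (j := j) (0 : V →ₗ[k] l) 0 i
  rwa [add_zero, left_eq_add] at this

omit [FiniteDimensional k l] in
theorem twistPart_lsmul (f : V →ₗ[k] l) (c : F) (i : ℕ) :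
    twistPart (F := F) j (f ∘ₗ (LinearMap.lsmul F V c).restrictScalars k) i =
      c • twistPart j f i := by
  rw [twistPart, ← LinearMap.comp_assoc, fLinearPart_lsmul]; rfl

omit [FiniteDimensional k l] in
theorem twistPart_mulLeft {f f' : V →ₗ[k] l} {z : l} (h : ∀ v, f' v = z * f v) (i : ℕ) (v : V) :
    twistPart (F := F) j f' i v = j z ^ Fintype.card k ^ i * twistPart (F := F) j f i v := by
  rw [twistPart, twistPart, ← fLinearPart_mulLeft]
  congr 2
  ext v
  simp [h, frobTwist_apply, mul_pow]

omit [FiniteDimensional k l] in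
theorem twistPart_pow {f f' : V →ₗ[k] l} {c : ℕ} (h : ∀ v, f' v = f v ^ Fintype.card k ^ c)
    (i : ℕ) : twistPart (F := F) j f' i = twistPart j f (c + i) := by
  rw [twistPart, twistPart]
  congr 1
  ext v
  simp [h, frobTwist_apply, pow_add, pow_mul]

omit [FiniteDimensional k l] in
theorem twistPart_comp {f f' : V →ₗ[k] l} {S : V →ₗ[F] V} (h : ∀ v, f' v = f (S v)) (i : ℕ)
    (v : V) : twistPart (F := F) j f' i v = twistPart (F := F) j f i (S v) := by
  rw [twistPart, twistPart, ← fLinearPart_comp]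
  congr 2
  ext v
  simp [h]

omit [FiniteDimensional k l] in
theorem twistPart_sum {ι : Type*} (s : Finset ι) (f : ι → V →ₗ[k] l) (i : ℕ) :
    twistPart (F := F) j (∑ a ∈ s, f a) i = ∑ a ∈ s, twistPart j (f a) i := by
  simp only [twistPart, ← fLinearPart_sum]
  congr 1
  ext v
  simp

/-- The coinvariants of the inertia group. -/
abbrev inertiaCoinv (ρ : Representation F G V) {D : Subgroup G} (I : Subgroup D) :=
  Representation.Coinvariants ((ρ.comp D.subtype).comp I.subtype)

/-- The projection to the coinvariants of the inertia group. -/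
abbrev coinvMk (ρ : Representation F G V) {D : Subgroup G} (I : Subgroup D) :
    V →ₗ[F] inertiaCoinv ρ I :=
  Representation.Coinvariants.mk ((ρ.comp D.subtype).comp I.subtype)

theorem coinvMk_apply_of_mem (ρ : Representation F G V) {D : Subgroup G} {I : Subgroup D} {γ : D}
    (hγ : γ ∈ I) (v : V) : coinvMk ρ I (ρ γ v) = coinvMk ρ I v :=
  Representation.Coinvariants.mk_self_apply ((ρ.comp D.subtype).comp I.subtype) ⟨γ, hγ⟩ v

/-- A linear map that is invariant under inertia is determined by its values on representatives of
a basis of the coinvariants. -/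
theorem eq_sum_of_inertia_invariant {D : Subgroup G} {I : Subgroup D} {r : ℕ}
    (b : Basis (Fin r) F (inertiaCoinv ρ I)) {w : Fin r → V} (hw : ∀ s, coinvMk ρ I (w s) = b s)
    (h : V →ₗ[F] E) (hI : ∀ γ ∈ I, ∀ v, h (ρ γ v) = h v) (v : V) :
    h v = ∑ s, b.repr (coinvMk ρ I v) s • h (w s) := by
  let h' : inertiaCoinv ρ I →ₗ[F] E :=
    Representation.Coinvariants.lift _ h fun γ => LinearMap.ext fun v => hI γ.1 γ.2 v
  have e : ∀ v, h' (coinvMk ρ I v) = h v := fun v => rfl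
  conv_lhs => rw [← e, ← b.sum_repr (coinvMk ρ I v), map_sum]
  refine Finset.sum_congr rfl fun s _ => ?_
  rw [map_smul, ← hw, e]

variable {D : Subgroup G} {I : Subgroup D} {σ : D} {d n : ℕ}

/-- The coordinates of an element of `Hom_{k[G]}(V, Bⁿ)`, reduced to the residue field. -/
def residueCoord (pr : B →ₐ[k] l) (f : homKG ρ (coordRep n α)) (a : Fin n) : V →ₗ[k] l :=
  pr.toLinearMap ∘ₗ LinearMap.proj a ∘ₗ f.1

omit [Fintype k] [Algebra k F] [FiniteDimensional k F] [IsScalarTower k F V]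
  [FiniteDimensional k l] in
theorem residueCoord_apply (f : homKG ρ (coordRep n α)) (a : Fin n) (v : V) :
    residueCoord pr f a v = pr (f.1 v a) := rfl

omit [Fintype k] [Algebra k F] [FiniteDimensional k F] [IsScalarTower k F V]
  [FiniteDimensional k l] in
theorem residueCoord_rho (f : homKG ρ (coordRep n α)) (a : Fin n) (g : G) (v : V) :
    residueCoord pr f a (ρ g v) = pr (α g (f.1 v a)) := by
  rw [residueCoord_apply, f.2 g v]; rfl

variable (pr j) in
/-- The coordinates of the map from `Hom_{k[G]}(V, Bⁿ)` to its description over `E`: the pair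
`(i, a)` of a Frobenius twist `i` and a coordinate `a` is encoded by the number `p = n * i + a`. -/
def residueMap (hn : 0 < n) (d : ℕ) {r : ℕ} (w : Fin r → V) :
    homKG ρ (coordRep n α) →ₗ[F] (Fin (d * n) × Fin r → E) where
  toFun f x := twistPart (F := F) j (residueCoord pr f ⟨x.1 % n, Nat.mod_lt _ hn⟩) (x.1 / n) (w x.2)
  map_add' f f' := by
    ext x
    have : ∀ a, residueCoord pr (f + f') a = residueCoord pr f a + residueCoord pr f' a := by
      intro a; ext v; exact map_add pr _ _
    simp [this, twistPart_add]
  map_smul' c f := by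
    ext x
    have : ∀ a, residueCoord pr (c • f) a =
      residueCoord pr f a ∘ₗ (LinearMap.lsmul F V c).restrictScalars k := fun a => rfl
    simp [this, twistPart_lsmul]

omit [FiniteDimensional k l] in
theorem residueMap_apply (hn : 0 < n) (d : ℕ) {r : ℕ} (w : Fin r → V)
    (f : homKG ρ (coordRep n α)) (p : Fin (d * n)) (s : Fin r) :
    residueMap pr j hn d w f (p, s) =
      twistPart (F := F) j (residueCoord pr f ⟨p % n, Nat.mod_lt _ hn⟩) (p / n) (w s) := rfl

omit [FiniteDimensional k l] in
theorem twistPart_residueCoord_inertia (H : IsReduction α pr D I σ d)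
    (f : homKG ρ (coordRep n α)) (a : Fin n) (i : ℕ) {γ : D} (hγ : γ ∈ I) (v : V) :
    twistPart (F := F) j (residueCoord pr f a) i (ρ γ v) =
      twistPart (F := F) j (residueCoord pr f a) i v :=
  (twistPart_comp (S := ρ γ) (fun v => by
    rw [residueCoord_rho, (H.mem_inertia γ).1 hγ]; rfl) i v).symm

omit [FiniteDimensional k l] in
/-- Raising the twist by the residue degree `d` amounts to composition with Frobenius. -/
theorem twistPart_residueCoord_frob (H : IsReduction α pr D I σ d)
    (f : homKG ρ (coordRep n α)) (a : Fin n) (i : ℕ) (v : V) :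
    twistPart (F := F) j (residueCoord pr f a) (d + i) v =
      twistPart (F := F) j (residueCoord pr f a) i (ρ σ v) := by
  let f' : V →ₗ[k] l := residueCoord pr f a ∘ₗ (ρ σ).restrictScalars k
  have h1 : twistPart (F := F) j f' i = twistPart j (residueCoord pr f a) (d + i) :=
    twistPart_pow (fun v => (residueCoord_rho f a σ v).trans (H.frob _)) i
  rw [← h1]
  exact twistPart_comp (S := ρ σ) (fun v => rfl) i v

/-- Relations over `E` between the images under `residueMap` give relations over `F` between the
reductions. By the invariance under inertia and the action of Frobenius, the relation extends from
the recorded values to all twists at all vectors. -/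
theorem sum_residueCoord_eq_zero (H : IsReduction α pr D I σ d) (hn : 0 < n) {r : ℕ}
    (b : Basis (Fin r) F (inertiaCoinv ρ I)) {w : Fin r → V} (hw : ∀ s, coinvMk ρ I (w s) = b s)
    {h : ℕ} (f : Fin h → homKG ρ (coordRep n α)) (c : Fin h → E)
    (hc : ∑ m, c m • residueMap pr j hn d w (f m) = 0) (π : E →ₗ[F] F) (a : Fin n) (v : V) :
    ∑ m, residueCoord pr (f m) a (π (c m) • v) = 0 := by
  refine sum_eq_zero_of_fLinearPart_frobTwist j (fun m => residueCoord pr (f m) a) c ?_ π v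
  intro i _
  change ∀ v, ∑ m, c m * twistPart (F := F) j (residueCoord pr (f m) a) i v = 0
  induction i using Nat.strong_induction_on with
  | _ i ih =>
    intro v
    by_cases hi : i < d
    · have hp : n * i + a < d * n := by
        have : n * i + n ≤ n * d := by
          rw [← Nat.mul_succ]; exact Nat.mul_le_mul_left _ hi
        have := a.isLt
        rw [mul_comm d n]
        omega
      have h1 : ∀ s, ∑ m, c m * twistPart (F := F) j (residueCoord pr (f m) a) i (w s) = 0 := by
        intro s
        have := congrFun hc (⟨n * i + a, hp⟩, s)
        rw [Finset.sum_apply] at this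
        simpa only [Pi.smul_apply, residueMap_apply, Nat.mul_add_mod, Nat.mod_eq_of_lt a.isLt,
          Nat.mul_add_div hn, Nat.div_eq_of_lt a.isLt, add_zero, smul_eq_mul,
          Pi.zero_apply] using this
      have h2 := fun m => eq_sum_of_inertia_invariant b hw
        (twistPart (F := F) j (residueCoord pr (f m) a) i)
        (fun γ hγ v => twistPart_residueCoord_inertia H _ _ _ hγ v) v
      simp only [h2, Finset.mul_sum]
      rw [Finset.sum_comm]
      refine Finset.sum_eq_zero fun s _ => ?_
      simp only [mul_smul_comm, ← Finset.smul_sum, h1, smul_zero]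
    · obtain ⟨i', rfl⟩ := Nat.exists_eq_add_of_le (not_lt.1 hi)
      simp only [twistPart_residueCoord_frob H]
      exact ih i' (by have := H.pos; omega) (by omega) _

/-- Together with `residueMap_span`, this says that the image of `residueMap` is an `F`-form of its
target. -/
theorem residueMap_linearIndependent (H : IsReduction α pr D I σ d) (hn : 0 < n) {r : ℕ}
    (b : Basis (Fin r) F (inertiaCoinv ρ I)) {w : Fin r → V} (hw : ∀ s, coinvMk ρ I (w s) = b s)
    (h : ℕ) (f : Fin h → homKG ρ (coordRep n α))
    (hf : LinearIndependent F (residueMap pr j hn d w ∘ f)) :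
    LinearIndependent E (residueMap pr j hn d w ∘ f) := by
  rw [Fintype.linearIndependent_iff] at hf ⊢
  intro c hc m
  rw [← Module.forall_dual_apply_eq_zero_iff F]
  intro π
  refine hf (fun m => π (c m)) ?_ m
  have hzero : ∀ a, residueCoord pr (∑ m, π (c m) • f m) a = 0 := by
    intro a
    ext v
    have := sum_residueCoord_eq_zero H hn b hw f c hc π a v
    rw [LinearMap.zero_apply, ← this, residueCoord_apply, AddSubgroup.val_finsetSum,
      LinearMap.sum_apply, Finset.sum_apply, map_sum]
    rfl
  simp only [Function.comp_apply, ← map_smul, ← map_sum]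
  ext ⟨p, s⟩
  rw [residueMap_apply, hzero, twistPart_zero]
  rfl

/-- The kernel consists of the maps with nilpotent values: applying a linear form `π` with
`π 1 ≠ 0` shows that the coordinates of an element of the kernel have zero reduction, and by
equivariance so do all their conjugates. -/
theorem residueMap_ker (H : IsReduction α pr D I σ d) (hn : 0 < n) {r : ℕ}
    (b : Basis (Fin r) F (inertiaCoinv ρ I)) {w : Fin r → V} (hw : ∀ s, coinvMk ρ I (w s) = b s)
    (f : homKG ρ (coordRep n α)) :
    residueMap pr j hn d w f = 0 ↔ ∀ v a, IsNilpotent (f.1 v a) := by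
  constructor
  · intro hf v a
    refine H.isNilpotent _ fun g => ?_
    rw [← residueCoord_rho]
    obtain ⟨π, hπ⟩ : ∃ π : E →ₗ[F] F, π 1 ≠ 0 := by
      by_contra! hcon
      exact one_ne_zero ((Module.forall_dual_apply_eq_zero_iff F (1 : E)).1 hcon)
    have := sum_residueCoord_eq_zero (j := j) H hn b hw (fun _ : Fin 1 => f) (fun _ => (1 : E))
      (by simp [hf]) π a ((π 1)⁻¹ • ρ g v)
    simpa [smul_smul, hπ] using this
  · intro hf
    have hzero : ∀ a, residueCoord pr f a = 0 := fun a => LinearMap.ext fun v =>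
      ((hf v a).map pr).eq_zero
    ext ⟨p, s⟩
    rw [residueMap_apply, hzero, twistPart_zero]
    rfl

end LocalFactor

/-! ### The image of the residue map -/

section LocalFactorComputation

open CarlitzL Module

variable {k F G V B l E : Type*} [Field k] [Fintype k] [Field F] [Algebra k F]
  [FiniteDimensional k F] [Group G] [AddCommGroup V] [Module k V] [Module F V]
  [IsScalarTower k F V] {ρ : Representation F G V}
  [CommRing B] [Algebra k B] [Algebra k[X] B] [IsScalarTower k k[X] B]
  {α : G →* (B →ₐ[k[X]] B)} [Field l] [Algebra k l] [FiniteDimensional k l] {pr : B →ₐ[k] l}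
  [Field E] [Algebra k E] [Algebra F E] [IsScalarTower k F E] {j : l →ₐ[k] E}
  {D : Subgroup G} {I : Subgroup D} {σ : D} {d n : ℕ}

omit [FiniteDimensional k F] in
/-- A `D`-equivariant map from `V` to the residue field lifts to a `G`-equivariant map to `B`. The
elements whose conjugates have the prescribed residues are unique up to nilpotents, and a high
power of Frobenius that is trivial on the residue field removes this ambiguity. -/
theorem exists_equivariant_lift [Finite B] (H : IsReduction α pr D I σ d) (f : V →ₗ[k] l)
    (hf : ∀ γ ∈ D, ∀ b v, pr b = f v → pr (α γ b) = f (ρ γ v)) :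
    ∃ f' : V →ₗ[k] B, (∀ v, pr (f' v) = f v) ∧ ∀ g v, f' (ρ g v) = α g (f' v) := by
  have : Finite l := Module.finite_of_finite k
  let _ := Fintype.ofFinite l
  have hx : ∀ v, ∃ b, ∀ g, pr (α g b) = f (ρ g v) := fun v =>
    H.exists_lift (fun g => f (ρ g v)) fun γ hγ g b hb => by
      rw [hf γ hγ b _ hb, map_mul]; rfl
  choose x hx using hx
  obtain ⟨N, hN⟩ := IsNoetherianRing.isNilpotent_nilradical B
  have hNb : ∀ b : B, IsNilpotent b → b ^ N = 0 := fun b hb => by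
    have : b ^ N ∈ nilradical B ^ N := Ideal.pow_mem_pow (mem_nilradical.2 hb) N
    rwa [hN] at this
  let Φ : B →ₐ[k] B := FiniteField.frobeniusAlgHom k B ^ (finrank k l * N)
  have hΦ : ∀ b, Φ b = b ^ Fintype.card k ^ (finrank k l * N) := fun b => by
    simp only [Φ, AlgHom.coe_pow, FiniteField.coe_frobeniusAlgHom, pow_iterate]
  have hle : N ≤ Fintype.card k ^ (finrank k l * N) :=
    (Nat.le_mul_of_pos_left N finrank_pos).trans (Nat.lt_pow_self Fintype.one_lt_card).le
  have huniq : ∀ b b', (∀ g, pr (α g b) = pr (α g b')) → Φ b = Φ b' := fun b b' h => by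
    rw [← sub_eq_zero, ← map_sub, hΦ]
    exact pow_eq_zero_of_le hle (hNb _ (H.isNilpotent _ fun g => by
      rw [map_sub, map_sub, h, sub_self]))
  have hl : ∀ y : l, y ^ Fintype.card k ^ (finrank k l * N) = y := fun y => by
    rw [pow_mul, ← Module.card_eq_pow_finrank (K := k) (V := l), FiniteField.pow_card_pow]
  have hα : ∀ (g : G) (c : k) (b : B), α g (c • b) = c • α g b := fun g c b =>
    ((α g).toLinearMap.restrictScalars k).map_smul c b
  refine ⟨⟨⟨fun v => Φ (x v), fun v v' => ?_⟩, fun c v => ?_⟩, fun v => ?_, fun g v => ?_⟩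
  · rw [← map_add]
    refine huniq _ _ fun g => ?_
    rw [map_add, map_add, hx, hx, hx, map_add, map_add]
  · rw [RingHom.id_apply, ← map_smul]
    refine huniq _ _ fun g => ?_
    rw [hα, map_smul, hx, hx, ← map_smul]
    congr 1
    exact ((ρ g).restrictScalars k).map_smul c v
  · have h1 := hx v 1
    rw [map_one, map_one] at h1
    change pr (Φ (x v)) = f v
    rw [hΦ, map_pow, hl]
    exact h1
  · change Φ (x (ρ g v)) = α g (Φ (x v))
    rw [hΦ (x v), map_pow, ← hΦ]
    refine huniq _ _ fun g' => ?_
    have h1 : α g' (α g (x v)) = α (g' * g) (x v) := by rw [map_mul]; rfl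
    rw [hx, h1, hx, map_mul]
    rfl

omit [Algebra k F] [FiniteDimensional k F] [IsScalarTower k F V] [IsScalarTower k k[X] B]
  [FiniteDimensional k l] in
/-- Compatibility with inertia and with one lift of Frobenius gives compatibility with the whole
decomposition group, which acts on the residue field through powers of Frobenius. -/
theorem apply_eq_of_mem_decomposition (H : IsReduction α pr D I σ d) (f : V →ₗ[k] l)
    (hI : ∀ γ ∈ I, ∀ v, f (ρ γ v) = f v) (hσ : ∀ v, f (ρ σ v) = f v ^ Fintype.card k ^ d)
    (γ : G) (hγ : γ ∈ D) (b : B) (v : V) (hb : pr b = f v) : pr (α γ b) = f (ρ γ v) := by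
  obtain ⟨i, hi⟩ := H.exists_pow γ hγ
  have hσi : ∀ (i : ℕ) b, pr (α ((σ ^ i : D) : G) b) = pr b ^ (Fintype.card k ^ d) ^ i := by
    intro i
    induction i with
    | zero => intro b; simp
    | succ i ih =>
      intro b
      rw [pow_succ, Subgroup.coe_mul, map_mul]
      change pr (α _ (α σ b)) = _
      rw [ih, H.frob, ← pow_mul, ← pow_succ']
  have hfi : ∀ (i : ℕ) v, f (ρ ((σ ^ i : D) : G) v) = f v ^ (Fintype.card k ^ d) ^ i := by
    intro i
    induction i with
    | zero => intro b; simp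
    | succ i ih =>
      intro v
      rw [pow_succ, Subgroup.coe_mul, map_mul]
      change f (ρ _ (ρ σ v)) = _
      rw [ih, hσ, ← pow_mul, ← pow_succ']
  have hmem : (⟨γ, hγ⟩ * (σ ^ i)⁻¹ : D) ∈ I := by
    rw [H.mem_inertia]
    intro b
    rw [Subgroup.coe_mul, map_mul]
    change pr (α γ (α _ b)) = _
    rw [hi, ← hσi]
    change pr ((α _ * α _) b) = _
    rw [← map_mul, ← Subgroup.coe_mul, mul_inv_cancel]
    simp
  rw [hi, hb, ← hfi, ← hI _ hmem]
  congr 1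
  rw [Subgroup.coe_mul, ← Module.End.mul_apply, ← map_mul]
  congr 2
  rw [mul_assoc, ← Subgroup.coe_mul, inv_mul_cancel, Subgroup.coe_one, mul_one]

theorem coinvMk_rho [I.Normal] (γ : D) (v : V) : coinvMk ρ I (ρ γ v) =
    Representation.toCoinvariants (ρ.comp D.subtype) I γ (coinvMk ρ I v) := rfl

/-- The image of `Hom_{k[G]}(V, Bⁿ)` spans its description over `E`. An element with only one
nonzero coordinate is a combination of the images of the `f t`, which arise from the maps
`v ↦ Tr (x v) * β t` by averaging over the powers of Frobenius; here `x` is a coordinate of the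
coinvariants, `β` a basis of the residue field and `c` the dual family for the conjugates
of `β`. -/
theorem residueMap_span [Finite B] [I.Normal] (H : IsReduction α pr D I σ d) (hn : 0 < n) {r : ℕ}
    (b : Basis (Fin r) F (inertiaCoinv ρ I)) {w : Fin r → V} (hw : ∀ s, coinvMk ρ I (w s) = b s) :
    Submodule.span E (Set.range (residueMap (ρ := ρ) (α := α) pr j hn d w)) = ⊤ := by
  classical
  have : Finite l := Module.finite_of_finite k
  let _ := Fintype.ofFinite l
  rw [← top_le_iff, ← (Pi.basisFun E (Fin (d * n) × Fin r)).span_eq, Submodule.span_le]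
  rintro _ ⟨⟨p₀, s₀⟩, rfl⟩
  let e := finrank k l / d
  have hed : d * e = finrank k l := Nat.mul_div_cancel' H.dvd
  have he : 0 < e := Nat.pos_of_ne_zero fun h => by
    rw [h, mul_zero] at hed
    exact (finrank_pos (R := k) (M := l)).ne hed
  have hdm : d ≤ finrank k l := Nat.le_of_dvd finrank_pos H.dvd
  have hi₀d : p₀.val / n < d := Nat.div_lt_of_lt_mul (p₀.isLt.trans_eq (mul_comm d n))
  let i₀ : Fin (finrank k l) := ⟨p₀.val / n, hi₀d.trans_le hdm⟩
  let a₀ : Fin n := ⟨p₀.val % n, Nat.mod_lt _ hn⟩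
  let β := finBasis k l
  obtain ⟨c, hc⟩ := exists_dual_conj j β i₀
  let x : V →ₗ[F] F := b.coord s₀ ∘ₗ coinvMk ρ I
  let u : Fin (finrank k l) → V →ₗ[k] l := fun t =>
    (LinearMap.toSpanSingleton k l (β t)) ∘ₗ ((Algebra.trace k F) ∘ₗ x.restrictScalars k)
  have hpow : ∀ y : l, y ^ Fintype.card k ^ finrank k l = y := fun y => by
    rw [← Module.card_eq_pow_finrank (K := k) (V := l), FiniteField.pow_card]
  -- `σ ^ e` acts on the residue field as the power of Frobenius with exponent `d * e = [l : k]`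
  have hσe : σ ^ e ∈ I := by
    rw [H.mem_inertia]
    have : ∀ (i : ℕ) b, pr (α ((σ ^ i : D) : G) b) = pr b ^ (Fintype.card k ^ d) ^ i := by
      intro i
      induction i with
      | zero => intro b; simp
      | succ i ih =>
        intro b
        rw [pow_succ, Subgroup.coe_mul, map_mul]
        change pr (α _ (α σ b)) = _
        rw [ih, H.frob, ← pow_mul, ← pow_succ']
    intro b
    rw [this, ← pow_mul, hed, hpow]
  -- the exponent is that of `Frob ^ (-d * h)`, made nonnegative by `Frob ^ (d * e) = 1`
  let g : Fin (finrank k l) → ℕ → V →ₗ[k] l := fun t h =>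
    (FiniteField.frobeniusAlgHom k l ^ (d * (e - h))).toLinearMap ∘ₗ u t ∘ₗ
      (ρ ((σ ^ h : D) : G)).restrictScalars k
  have hg : ∀ t h v, g t h v =
      u t (ρ ((σ ^ h : D) : G) v) ^ Fintype.card k ^ (d * (e - h)) := fun t h v => by
    simp only [g, LinearMap.comp_apply, AlgHom.toLinearMap_apply, AlgHom.coe_pow,
      FiniteField.coe_frobeniusAlgHom, pow_iterate, LinearMap.restrictScalars_apply]
  let f : Fin (finrank k l) → V →ₗ[k] l := fun t => ∑ h ∈ Finset.range e, g t h
  have hxI : ∀ γ ∈ I, ∀ v, x (ρ γ v) = x v := fun γ hγ v => by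
    simp only [x, LinearMap.comp_apply, coinvMk_apply_of_mem ρ hγ]
  have hxσI : ∀ (h : ℕ), ∀ γ ∈ I, ∀ v, x (ρ ((σ ^ h : D) : G) (ρ γ v)) =
      x (ρ ((σ ^ h : D) : G) v) := fun h γ hγ v => by
    simp only [x, LinearMap.comp_apply, coinvMk_rho, coinvMk_apply_of_mem ρ hγ]
  have huI : ∀ t (v v' : V), x v = x v' → u t v = u t v' := fun t v v' h => by
    simp only [u, LinearMap.comp_apply, LinearMap.restrictScalars_apply, h]
  have hfI : ∀ t, ∀ γ ∈ I, ∀ v, f t (ρ γ v) = f t v := fun t γ hγ v => by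
    simp only [f, LinearMap.sum_apply, hg]
    exact Finset.sum_congr rfl fun h _ => by rw [huI t _ _ (hxσI h γ hγ v)]
  have hfσ : ∀ t v, f t (ρ σ v) = f t v ^ Fintype.card k ^ d := fun t v => by
    -- both sides are sums over the terms `A h`, shifted by one, and `A e = A 0`
    let A : ℕ → l := fun h => u t (ρ ((σ ^ h : D) : G) v) ^ Fintype.card k ^ (d * (e - h) + d)
    have h1 : f t (ρ σ v) = ∑ h ∈ Finset.range e, A (h + 1) := by
      simp only [f, LinearMap.sum_apply, hg, A]
      refine Finset.sum_congr rfl fun h hh => ?_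
      have h2 : d * (e - (h + 1)) + d = d * (e - h) := by
        rw [← Nat.mul_succ]
        congr 1
        have := Finset.mem_range.1 hh
        omega
      rw [h2, pow_succ, Subgroup.coe_mul, map_mul]
      rfl
    have h2 : f t v ^ Fintype.card k ^ d = ∑ h ∈ Finset.range e, A h := by
      have : ∀ y : l, y ^ Fintype.card k ^ d = (FiniteField.frobeniusAlgHom k l ^ d) y := by
        intro y
        simp only [AlgHom.coe_pow, FiniteField.coe_frobeniusAlgHom, pow_iterate]
      rw [this]
      simp only [f, LinearMap.sum_apply, map_sum]
      refine Finset.sum_congr rfl fun h _ => ?_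
      rw [← this, hg, ← pow_mul, ← pow_add]
    have h3 : A e = A 0 := by
      simp only [A, Nat.sub_self, Nat.sub_zero, mul_zero, zero_add, pow_zero, hed]
      rw [huI t _ _ (hxI _ hσe v), pow_add, pow_mul, hpow]
      simp
    have h4 := Finset.sum_range_succ A e
    rw [Finset.sum_range_succ' A e, h3] at h4
    rw [h1, h2]
    exact add_right_cancel h4
  choose f' hf' hf'' using fun t => exists_equivariant_lift (ρ := ρ) H (f t)
    fun γ hγ b v hb => apply_eq_of_mem_decomposition H (f t) (hfI t) (hfσ t) γ hγ b v hb
  let m : Fin (finrank k l) → homKG ρ (coordRep n α) := fun t =>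
    ⟨LinearMap.single k (fun _ : Fin n => B) a₀ ∘ₗ f' t, fun g v => by
      ext a
      change (Pi.single a₀ (f' t (ρ g v)) : Fin n → B) a = α g ((Pi.single a₀ (f' t v) : _ → B) a)
      by_cases ha : a = a₀
      · subst ha
        simp [hf'']
      · simp [ha]⟩
  have hm : ∀ t a, residueCoord pr (m t) a = if a = a₀ then f t else 0 := by
    intro t a
    ext v
    change pr ((Pi.single a₀ (f' t v) : Fin n → B) a) = _
    split_ifs with h
    · subst h
      simp [hf']
    · simp [h]
  have hgtw : ∀ t h i v, twistPart (F := F) j (g t h) i v =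
      algebraMap F E (x (ρ ((σ ^ h : D) : G) v)) * frobTwist j (d * (e - h) + i) (β t) := by
    intro t h i v
    rw [twistPart_comp (F := F)
      (f := (FiniteField.frobeniusAlgHom k l ^ (d * (e - h))).toLinearMap ∘ₗ u t)
      (S := ρ ((σ ^ h : D) : G)) (fun v => rfl),
      twistPart_pow (F := F) (f := u t) (c := d * (e - h))]
    · refine Eq.trans ?_ (fLinearPart_trace (k := k) x _ _)
      rw [twistPart]
      congr 2
      ext v
      simp [u]
    · intro v
      simp only [LinearMap.comp_apply, AlgHom.toLinearMap_apply, AlgHom.coe_pow,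
        FiniteField.coe_frobeniusAlgHom, pow_iterate]
  -- for `h > 0` the twist `d * (e - h) + i` is at least `d > i₀` and less than `[l : k]`, so that
  -- the dual family `c` kills the term; for `h = 0` it is congruent to `i` modulo `[l : k]`
  have hsum : ∀ i < d, ∀ v, ∑ t, c t * twistPart (F := F) j (f t) i v =
      if i = i₀.val then algebraMap F E (x v) else 0 := by
    intro i hi v
    simp only [f, twistPart_sum, LinearMap.sum_apply, hgtw, Finset.mul_sum]
    rw [Finset.sum_comm]
    have h1 : ∀ h, ∑ t, c t * (algebraMap F E (x (ρ ((σ ^ h : D) : G) v)) *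
        frobTwist j (d * (e - h) + i) (β t)) = algebraMap F E (x (ρ ((σ ^ h : D) : G) v)) *
        ∑ t, c t * frobTwist j (d * (e - h) + i) (β t) := fun h => by
      rw [Finset.mul_sum]
      exact Finset.sum_congr rfl fun t _ => by ring
    simp only [h1]
    rw [Finset.sum_eq_single 0]
    · have h2 : ∀ t, frobTwist j (d * (e - 0) + i) (β t) = frobTwist j i (β t) := fun t => by
        rw [Nat.sub_zero, hed, frobTwist_apply, frobTwist_apply, pow_add, pow_mul, ← map_pow, hpow]
      simp only [h2]
      rw [hc ⟨i, hi.trans_le hdm⟩]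
      simp only [Fin.ext_iff]
      split_ifs <;> simp
    · intro h hh hne
      have hlt : d * (e - h) + i < finrank k l := by
        have h3 : d * (e - h) + d ≤ d * e := by
          rw [← Nat.mul_succ]
          exact Nat.mul_le_mul_left _ (by have := Finset.mem_range.1 hh; omega)
        omega
      rw [hc ⟨_, hlt⟩, if_neg, mul_zero]
      simp only [Fin.ext_iff, i₀]
      have h3 : d * 1 ≤ d * (e - h) :=
        Nat.mul_le_mul_left _ (by have := Finset.mem_range.1 hh; omega)
      omega
    · intro h
      exact absurd (Finset.mem_range.2 he) h
  have key : (Pi.basisFun E (Fin (d * n) × Fin r)) (p₀, s₀) =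
      ∑ t, c t • residueMap pr j hn d w (m t) := by
    ext ⟨p, s⟩
    rw [Finset.sum_apply]
    simp only [Pi.smul_apply, residueMap_apply, hm, smul_eq_mul]
    have hpd : p.val / n < d := Nat.div_lt_of_lt_mul (p.isLt.trans_eq (mul_comm d n))
    have hxw : x (w s) = if s = s₀ then 1 else 0 := by
      simp only [x, LinearMap.comp_apply, hw, Basis.coord_apply, Basis.repr_self,
        Finsupp.single_apply]
    by_cases h1 : p.val % n = p₀.val % n
    · have h1' : (⟨p.val % n, Nat.mod_lt _ hn⟩ : Fin n) = a₀ := Fin.ext h1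
      simp only [h1', if_true]
      rw [hsum _ hpd, hxw]
      by_cases h2 : p.val / n = p₀.val / n
      · have h3 : p = p₀ := Fin.ext (by
          rw [← Nat.div_add_mod p.val n, ← Nat.div_add_mod p₀.val n, h1, h2])
        subst h3
        simp [i₀, Pi.single_apply, apply_ite]
      · have h3 : p ≠ p₀ := fun h => h2 (by rw [h])
        simp [i₀, h2, h3]
    · have h1' : (⟨p.val % n, Nat.mod_lt _ hn⟩ : Fin n) ≠ a₀ := fun h => h1 (congrArg Fin.val h)
      have h3 : p ≠ p₀ := fun h => h1 (by rw [h])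
      simp [h1', h3, twistPart_zero]
  rw [key]
  exact Submodule.sum_mem _ fun t _ => Submodule.smul_mem _ _ (Submodule.subset_span ⟨_, rfl⟩)

end LocalFactorComputation

/-! ### The action of `t` on `Hom_{k[G]}(V, Bⁿ)` -/

section LocalFactorFormula

open CarlitzL Module

variable {k F G V B l E : Type*} [Field k] [Fintype k] [Field F] [Algebra k F]
  [FiniteDimensional k F] [Group G] [AddCommGroup V] [Module k V] [Module F V]
  [IsScalarTower k F V] {ρ : Representation F G V}
  [CommRing B] [Algebra k B] [Algebra k[X] B] [IsScalarTower k k[X] B]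
  {α : G →* (B →ₐ[k[X]] B)} [Field l] [Algebra k l] [FiniteDimensional k l] {pr : B →ₐ[k] l}
  [Field E] [Algebra k E] [Algebra F E] [IsScalarTower k F E] {j : l →ₐ[k] E}
  {D : Subgroup G} {I : Subgroup D} {σ : D} {d n r : ℕ}

omit [FiniteDimensional k l] in
theorem residueMap_apply_of_eq (hn : 0 < n) (w : Fin r → V) (f : homKG ρ (coordRep n α))
    (p : Fin (d * n)) (s : Fin r) {i : ℕ} {a : Fin n} (h : p.val = n * i + a) :
    residueMap pr j hn d w f (p, s) = twistPart (F := F) j (residueCoord pr f a) i (w s) := by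
  rw [residueMap_apply]
  have h1 : p.val / n = i := by
    rw [h, Nat.mul_add_div hn, Nat.div_eq_of_lt a.isLt, add_zero]
  have h2 : (⟨p.val % n, Nat.mod_lt _ hn⟩ : Fin n) = a :=
    Fin.ext ((congrArg (· % n) h).trans (by rw [Nat.mul_add_mod, Nat.mod_eq_of_lt a.isLt]))
  rw [h1, h2]

omit [IsScalarTower k k[X] B] in
theorem carlitz_X_apply (x : Fin n → B) (a : Fin n) :
    carlitz k n B Polynomial.X x a = algebraMap k[X] B Polynomial.X * x a +
      if h : a.val + 1 < n then x ⟨a.val + 1, h⟩ else x ⟨0, a.pos⟩ ^ Fintype.card k := by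
  rw [carlitz, Polynomial.aeval_X]
  rfl

omit [Fintype k] [IsScalarTower k k[X] B] in
theorem carlitzLie_X_apply (x : Fin n → B) (a : Fin n) :
    carlitzLie k n B Polynomial.X x a = algebraMap k[X] B Polynomial.X * x a +
      if h : a.val + 1 < n then x ⟨a.val + 1, h⟩ else 0 := by
  rw [carlitzLie, Polynomial.aeval_X]
  rfl

omit [FiniteDimensional k l] in
/-- Over `E`, the action of `t` on `Hom_{k[G]}(V, C^{⊗n}(B))` becomes a cyclic block matrix: passing
from the last coordinate to the first one raises the Frobenius twist by one, and `d` twists amount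
to the action of the Frobenius element on the coinvariants. -/
theorem residueMap_carlitz [I.Normal] (H : IsReduction α pr D I σ d) (hn : 0 < n)
    (b : Basis (Fin r) F (inertiaCoinv ρ I)) {w : Fin r → V} (hw : ∀ s, coinvMk ρ I (w s) = b s)
    (f : homKG ρ (coordRep n α)) :
    residueMap pr j hn d w
        (homMap ρ (coordRep n α) (carlitz k n B Polynomial.X) (carlitz_coordRep α) f) =
      (cyclicBlockMatrix
        (fun p : Fin (d * n) =>
          j (pr (algebraMap k[X] B Polynomial.X)) ^ Fintype.card k ^ (p.val / n)) (fun _ => 1)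
        ((LinearMap.toMatrix b b
          (Representation.toCoinvariants (ρ.comp D.subtype) I σ)).transpose.map
            (algebraMap F E))).mulVec (residueMap pr j hn d w f) := by
  ext ⟨p, s⟩
  rw [cyclicBlockMatrix_mulVec]
  set A := homMap ρ (coordRep n α) (carlitz k n B Polynomial.X) (carlitz_coordRep α) with hA
  let z := pr (algebraMap k[X] B Polynomial.X)
  let i := p.val / n
  let a : Fin n := ⟨p.val % n, Nat.mod_lt _ hn⟩
  have hp : p.val = n * i + a := (Nat.div_add_mod _ _).symm
  have hi : i < d := Nat.div_lt_of_lt_mul (p.isLt.trans_eq (mul_comm d n))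
  let g : V →ₗ[k] l := (LinearMap.mulLeft k z) ∘ₗ residueCoord pr f a
  have hg : twistPart (F := F) j g i (w s) = j z ^ Fintype.card k ^ i *
      twistPart (F := F) j (residueCoord pr f a) i (w s) :=
    twistPart_mulLeft (fun v => rfl) i (w s)
  rw [residueMap_apply_of_eq hn w _ p s hp, residueMap_apply_of_eq hn w _ p s hp]
  by_cases ha : a.val + 1 < n
  · have h1 : residueCoord pr (A f) a = g + residueCoord pr f ⟨a.val + 1, ha⟩ := by
      ext v
      change pr (carlitz k n B Polynomial.X (f.1 v) a) = z * pr _ + pr _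
      rw [carlitz_X_apply, dif_pos ha, map_add, map_mul]
      rfl
    have hp1 : p.val + 1 < d * n := by
      have : n * i + n ≤ n * d := by
        rw [← Nat.mul_succ]; exact Nat.mul_le_mul_left _ hi
      have := mul_comm d n
      omega
    rw [h1, twistPart_add, LinearMap.add_apply, hg, dif_pos hp1, one_mul,
      residueMap_apply_of_eq hn w _ _ s
        (show p.val + 1 = n * i + (⟨a.val + 1, ha⟩ : Fin n).val by rw [hp]; rfl)]
  · let g' : V →ₗ[k] l :=
      (FiniteField.frobeniusAlgHom k l).toLinearMap ∘ₗ residueCoord pr f ⟨0, hn⟩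
    have h1 : residueCoord pr (A f) a = g + g' := by
      ext v
      change pr (carlitz k n B Polynomial.X (f.1 v) a) = z * pr _ + pr _ ^ Fintype.card k
      rw [carlitz_X_apply, dif_neg ha, map_add, map_mul, map_pow]
      rfl
    have h2 : twistPart (F := F) j g' i = twistPart j (residueCoord pr f ⟨0, hn⟩) (1 + i) :=
      twistPart_pow (fun v => by rw [pow_one]; rfl) i
    have hn1 : a.val + 1 = n := le_antisymm a.isLt (not_lt.1 ha)
    have hp1 : p.val + 1 = n * (i + 1) := by rw [hp, Nat.mul_succ]; omega
    rw [h1, twistPart_add, LinearMap.add_apply, hg, h2, add_comm 1 i]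
    congr 1
    by_cases hid : i + 1 < d
    · have hp2 : p.val + 1 < d * n := by
        exact hp1.trans_lt ((Nat.mul_lt_mul_of_pos_left hid hn).trans_eq (mul_comm n d))
      rw [dif_pos hp2, one_mul, residueMap_apply_of_eq hn w _ _ s
        (show p.val + 1 = n * (i + 1) + (⟨0, hn⟩ : Fin n).val by rw [hp1]; rfl)]
    · have hid' : i + 1 = d := le_antisymm hi (not_lt.1 hid)
      have hp2 : ¬ p.val + 1 < d * n := by
        rw [hp1, hid', mul_comm d n]
        exact lt_irrefl _
      rw [dif_neg hp2, hid']
      have h3 := twistPart_residueCoord_frob (j := j) H f ⟨0, hn⟩ 0 (w s)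
      rw [add_zero] at h3
      rw [h3, eq_sum_of_inertia_invariant b hw (twistPart (F := F) j (residueCoord pr f ⟨0, hn⟩) 0)
        (fun γ hγ v => twistPart_residueCoord_inertia H _ _ _ hγ v)]
      refine Finset.sum_congr rfl fun s' _ => ?_
      rw [residueMap_apply_of_eq hn w _ ⟨0, p.pos⟩ s'
        (show 0 = n * 0 + (⟨0, hn⟩ : Fin n).val by simp), Matrix.map_apply,
        Matrix.transpose_apply, LinearMap.toMatrix_apply, coinvMk_rho, hw, Algebra.smul_def]

omit [FiniteDimensional k l] in
theorem residueMap_carlitzLie (hn : 0 < n) (w : Fin r → V) (f : homKG ρ (coordRep n α)) :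
    residueMap pr j hn d w
        (homMap ρ (coordRep n α) (carlitzLie k n B Polynomial.X) (carlitzLie_coordRep α) f) =
      (cyclicBlockMatrix
        (fun p : Fin (d * n) =>
          j (pr (algebraMap k[X] B Polynomial.X)) ^ Fintype.card k ^ (p.val / n))
        (fun p => if p.val % n + 1 < n then 1 else 0) 0).mulVec (residueMap pr j hn d w f) := by
  ext ⟨p, s⟩
  rw [cyclicBlockMatrix_mulVec]
  set A := homMap ρ (coordRep n α) (carlitzLie k n B Polynomial.X) (carlitzLie_coordRep α) with hA
  let z := pr (algebraMap k[X] B Polynomial.X)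
  let i := p.val / n
  let a : Fin n := ⟨p.val % n, Nat.mod_lt _ hn⟩
  have hp : p.val = n * i + a := (Nat.div_add_mod _ _).symm
  have hi : i < d := Nat.div_lt_of_lt_mul (p.isLt.trans_eq (mul_comm d n))
  let g : V →ₗ[k] l := (LinearMap.mulLeft k z) ∘ₗ residueCoord pr f a
  have hg : twistPart (F := F) j g i (w s) = j z ^ Fintype.card k ^ i *
      twistPart (F := F) j (residueCoord pr f a) i (w s) :=
    twistPart_mulLeft (fun v => rfl) i (w s)
  rw [residueMap_apply_of_eq hn w _ p s hp, residueMap_apply_of_eq hn w _ p s hp]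
  by_cases ha : a.val + 1 < n
  · have h1 : residueCoord pr (A f) a = g + residueCoord pr f ⟨a.val + 1, ha⟩ := by
      ext v
      change pr (carlitzLie k n B Polynomial.X (f.1 v) a) = z * pr _ + pr _
      rw [carlitzLie_X_apply, dif_pos ha, map_add, map_mul]
      rfl
    have hp1 : p.val + 1 < d * n := by
      have : n * i + n ≤ n * d := by
        rw [← Nat.mul_succ]; exact Nat.mul_le_mul_left _ hi
      have := mul_comm d n
      omega
    rw [h1, twistPart_add, LinearMap.add_apply, hg, dif_pos hp1, if_pos ha, one_mul,
      residueMap_apply_of_eq hn w _ _ s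
        (show p.val + 1 = n * i + (⟨a.val + 1, ha⟩ : Fin n).val by rw [hp]; rfl)]
  · have h1 : residueCoord pr (A f) a = g := by
      ext v
      change pr (carlitzLie k n B Polynomial.X (f.1 v) a) = z * pr _
      rw [carlitzLie_X_apply, dif_neg ha, map_add, map_mul, map_zero, add_zero]
      rfl
    have ha' : ¬ p.val % n + 1 < n := ha
    rw [h1, hg]
    simp [ha', z, i]

instance finiteDimensional_homKG [Finite B] [FiniteDimensional F V] :
    FiniteDimensional F (homKG ρ (coordRep n α)) := by
  have : Finite F := Module.finite_of_finite k
  have : Finite V := Module.finite_of_finite F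
  have : Finite (V →ₗ[k] (Fin n → B)) := Finite.of_injective _ DFunLike.coe_injective
  exact Module.Finite.of_finite

/-- On the subspace of maps with nilpotent values, filtered by the powers of the nilradical, the
two actions of `t` differ by a map of positive degree, so that they have the same characteristic
polynomial. -/
theorem charpoly_restrict_ker_eq [Finite B] [FiniteDimensional F V]
    (H : IsReduction α pr D I σ d) (hn : 0 < n) (b : Basis (Fin r) F (inertiaCoinv ρ I))
    {w : Fin r → V} (hw : ∀ s, coinvMk ρ I (w s) = b s)
    (hC : LinearMap.ker (residueMap (ρ := ρ) (α := α) pr j hn d w) ≤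
      (LinearMap.ker (residueMap pr j hn d w)).comap
        (homMap ρ (coordRep n α) (carlitz k n B Polynomial.X) (carlitz_coordRep α)))
    (hL : LinearMap.ker (residueMap (ρ := ρ) (α := α) pr j hn d w) ≤
      (LinearMap.ker (residueMap pr j hn d w)).comap
        (homMap ρ (coordRep n α) (carlitzLie k n B Polynomial.X) (carlitzLie_coordRep α))) :
    ((homMap ρ (coordRep n α) (carlitz k n B Polynomial.X) (carlitz_coordRep α)).restrict
        hC).charpoly =
      ((homMap ρ (coordRep n α) (carlitzLie k n B Polynomial.X) (carlitzLie_coordRep α)).restrict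
        hL).charpoly := by
  let 𝔫 := nilradical B
  obtain ⟨N, hN⟩ := IsNoetherianRing.isNilpotent_nilradical B
  let φ := residueMap (ρ := ρ) (α := α) pr j hn d w
  let p : ℕ → Submodule F (LinearMap.ker φ) := fun i =>
    { carrier := {f | ∀ v a, f.1.1 v a ∈ 𝔫 ^ (i + 1)}
      zero_mem' := fun v a => Ideal.zero_mem _
      add_mem' := fun hf hf' v a => Ideal.add_mem _ (hf v a) (hf' v a)
      smul_mem' := fun c f hf v a => hf (c • v) a }
  refine LinearMap.charpoly_eq_of_filtration N p ?_ ?_ ?_ _ _ ?_ ?_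
  · intro i i' hii f hf v a
    exact Ideal.pow_le_pow_right (Nat.succ_le_succ hii) (hf v a)
  · refine eq_top_iff.2 fun f _ v a => ?_
    rw [zero_add, pow_one]
    exact mem_nilradical.2 ((residueMap_ker H hn b hw f.1).1 f.2 v a)
  · refine eq_bot_iff.2 fun f hf => ?_
    have : ∀ v a, f.1.1 v a = 0 := fun v a => by
      have h1 := hf v a
      rwa [pow_succ, hN, zero_mul] at h1
    refine (Submodule.mem_bot F).2 (Subtype.ext (Subtype.ext (LinearMap.ext fun v => ?_)))
    exact funext (this v)
  · intro i f hf v a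
    change carlitz k n B Polynomial.X (f.1.1 v) a ∈ _
    rw [carlitz_X_apply]
    refine Ideal.add_mem _ (Ideal.mul_mem_left _ _ (hf v a)) ?_
    split_ifs
    · exact hf v _
    · exact Ideal.pow_mem_of_mem _ (hf v _) _ Fintype.card_pos
  · intro i f hf v a
    change carlitz k n B Polynomial.X (f.1.1 v) a - carlitzLie k n B Polynomial.X (f.1.1 v) a ∈ _
    rw [carlitz_X_apply, carlitzLie_X_apply, add_sub_add_left_eq_sub]
    split_ifs
    · rw [sub_self]
      exact Ideal.zero_mem _
    · rw [sub_zero]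
      have h1 := Ideal.pow_mem_pow (hf v ⟨0, hn⟩) (Fintype.card k)
      rw [← pow_mul] at h1
      refine Ideal.pow_le_pow_right ?_ h1
      have h2 := Nat.mul_le_mul_left (i + 1) (Nat.succ_le_iff.2 (Fintype.one_lt_card (α := k)))
      omega

/-- The characteristic polynomials that give the local factor of `L(C^{⊗n}, ρ)`, in terms of the
polynomial `f` of the residue field and the matrix of Frobenius on the coinvariants. -/
theorem charPol_carlitz [Finite B] [FiniteDimensional F V] [I.Normal]
    (H : IsReduction α pr D I σ d) (hn : 0 < n) (b : Basis (Fin r) F (inertiaCoinv ρ I))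
    (f : F[X]) (hf : f.map (algebraMap F E) = ∏ i ∈ Finset.range d, (Polynomial.X -
      Polynomial.C (j (pr (algebraMap k[X] B Polynomial.X)) ^ Fintype.card k ^ i))) :
    ∃ c : F[X], c ≠ 0 ∧
      charPol (homMap ρ (coordRep n α) (carlitzLie k n B Polynomial.X) (carlitzLie_coordRep α)) =
        c * f ^ (n * r) ∧
      charPol (homMap ρ (coordRep n α) (carlitz k n B Polynomial.X) (carlitz_coordRep α)) =
        c * ((f ^ n) • (1 : Matrix (Fin r) (Fin r) F[X]) -
          (LinearMap.toMatrix b b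
            (Representation.toCoinvariants (ρ.comp D.subtype) I σ)).map Polynomial.C).det := by
  have hw : ∀ s, ∃ w, coinvMk ρ I w = b s := fun s =>
    Representation.Coinvariants.mk_surjective _ (b s)
  choose w hw using hw
  set S := LinearMap.toMatrix b b (Representation.toCoinvariants (ρ.comp D.subtype) I σ)
  set z := pr (algebraMap k[X] B Polynomial.X)
  let φ := residueMap (ρ := ρ) (α := α) pr j hn d w
  set AC := homMap ρ (coordRep n α) (carlitz k n B Polynomial.X) (carlitz_coordRep α)
  set AL := homMap ρ (coordRep n α) (carlitzLie k n B Polynomial.X) (carlitzLie_coordRep α)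
  have hφC := residueMap_carlitz (j := j) H hn b hw
  have hφL := residueMap_carlitzLie (ρ := ρ) (α := α) (pr := pr) (j := j) (d := d) hn w
  have hC : LinearMap.ker φ ≤ (LinearMap.ker φ).comap AC := fun x hx => by
    rw [Submodule.mem_comap, LinearMap.mem_ker]
    refine (hφC x).trans ?_
    rw [show residueMap pr j hn d w x = 0 from hx, Matrix.mulVec_zero]
  have hL : LinearMap.ker φ ≤ (LinearMap.ker φ).comap AL := fun x hx => by
    rw [Submodule.mem_comap, LinearMap.mem_ker]
    refine (hφL x).trans ?_
    rw [show residueMap pr j hn d w x = 0 from hx, Matrix.mulVec_zero]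
  have hspan := residueMap_span (j := j) H hn b hw
  have hind := residueMap_linearIndependent (j := j) (α := α) H hn b hw
  have eC := LinearMap.map_charpoly_eq_mul_of_form φ hspan hind AC (Matrix.toLin' _) hφC hC
  have eL := LinearMap.map_charpoly_eq_mul_of_form φ hspan hind AL (Matrix.toLin' _) hφL hL
  have hprod : ∏ p : Fin (d * n),
      (Polynomial.X - Polynomial.C (j z ^ Fintype.card k ^ (p.val / n))) =
        (f ^ n).map (algebraMap F E) := by
    rw [Polynomial.map_pow, hf, ← finProdFinEquiv.prod_comp, Fintype.prod_prod_type,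
      ← Finset.prod_pow, ← Fin.prod_univ_eq_prod_range
        (fun i => (Polynomial.X - Polynomial.C (j z ^ Fintype.card k ^ i)) ^ n) d]
    refine Finset.prod_congr rfl fun i _ => ?_
    have : ∀ a, (finProdFinEquiv (i, a)).val / n = i := fun a => by
      rw [finProdFinEquiv_apply_val, Nat.add_mul_div_left _ _ hn, Nat.div_eq_of_lt a.isLt, zero_add]
    simp only [this, Finset.prod_const, Finset.card_univ, Fintype.card_fin]
  have hinj := Polynomial.map_injective _ (algebraMap F E).injective
  refine ⟨(AC.restrict hC).charpoly, (LinearMap.charpoly_monic _).ne_zero, ?_, ?_⟩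
  · rw [charPol_eq_charpoly]
    refine hinj (eL.trans ?_)
    rw [Matrix.charpoly_toLin', Matrix.charpoly, charmatrix_cyclicBlockMatrix, Matrix.map_zero,
      neg_zero, cyclicBlockMatrix_zero_det, hprod, Polynomial.map_mul,
      charpoly_restrict_ker_eq H hn b hw hC hL, ← Polynomial.map_pow, ← pow_mul]
    simp
  · rw [charPol_eq_charpoly]
    refine hinj (eC.trans ?_)
    rw [Matrix.charpoly_toLin', Matrix.charpoly, charmatrix_cyclicBlockMatrix, map_one,
      det_cyclicBlockMatrix (Nat.mul_pos H.pos hn) _ (fun p => Polynomial.X_sub_C_ne_zero _),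
      hprod, Polynomial.map_mul, ← Matrix.det_transpose]
    congr 1
    rw [← Polynomial.coe_mapRingHom, RingHom.map_det]
    congr 1
    ext1 s s'
    rw [Matrix.transpose_apply, Matrix.sub_apply, Matrix.smul_apply, Matrix.map_apply,
      Matrix.map_apply, Matrix.transpose_apply, RingHom.mapMatrix_apply, Matrix.map_apply,
      Matrix.sub_apply, Matrix.smul_apply, Matrix.map_apply, Polynomial.coe_mapRingHom,
      Polynomial.map_sub, Polynomial.map_C]
    by_cases h : s = s'
    · subst h
      simp
      rfl
    · simp [h, Ne.symm h]
      rfl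

end LocalFactorFormula

/-! ### The local factors -/

section ResidueFields

open CarlitzL Module

variable {k R l : Type*} [Field k] [CommRing R] [Algebra k R] [Field l] [Algebra k l]

/-- The residue field of a maximal ideal, as a field `l` with a projection whose kernel is the
ideal. This form avoids working with the field structure on the type of the quotient ring. -/
theorem exists_residueField.{u, v} (k : Type u) {R : Type v} [Field k] [CommRing R] [Algebra k R]
    (m : Ideal R) [m.IsMaximal] : ∃ (l : Type v) (_ : Field l) (_ : Algebra k l) (π : R →ₐ[k] l),
      Function.Surjective π ∧ RingHom.ker π = m :=
  ⟨R ⧸ m, Ideal.Quotient.field m, inferInstance, Ideal.Quotient.mkₐ k m,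
    Ideal.Quotient.mkₐ_surjective k m, Ideal.Quotient.mkₐ_ker k m⟩

theorem finrank_quotient_dvd_finrank (m : Ideal R) [m.IsMaximal] (ι : R ⧸ m →ₐ[k] l) :
    finrank k (R ⧸ m) ∣ finrank k l := by
  let _ : Field (R ⧸ m) := Ideal.Quotient.field m
  let _ : Algebra (R ⧸ m) l := ι.toRingHom.toAlgebra
  have : IsScalarTower k (R ⧸ m) l := IsScalarTower.of_algebraMap_eq' ι.comp_algebraMap.symm
  exact Dvd.intro _ (finrank_mul_finrank k (R ⧸ m) l)

theorem finrank_quotient_pos (k : Type*) [Field k] [Algebra k R] (m : Ideal R) [hm : m.IsMaximal]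
    [Finite (R ⧸ m)] : 0 < finrank k (R ⧸ m) := by
  have : Nontrivial (R ⧸ m) := Ideal.Quotient.nontrivial_iff.2 hm.ne_top
  have : FiniteDimensional k (R ⧸ m) := Module.Finite.of_finite
  exact finrank_pos

theorem natDegree_charPol {M : Type*} [AddCommGroup M] [Module k M] [Finite M] (T : M →ₗ[k] M) :
    (charPol T).natDegree = finrank k M := by
  have : FiniteDimensional k M := Module.Finite.of_finite
  rw [charPol_eq_charpoly, LinearMap.charpoly_natDegree]

theorem natCard_eq_pow_finrank [Fintype k] (M : Type*) [AddCommGroup M] [Module k M] [Finite M] :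
    Nat.card M = Fintype.card k ^ finrank k M := by
  let _ := Fintype.ofFinite M
  rw [Nat.card_eq_fintype_card, Module.card_eq_pow_finrank (K := k)]

theorem map_charPol_mulLeft_quotient [Fintype k] (m : Ideal R) [m.IsMaximal] [Finite (R ⧸ m)]
    (ψ : R ⧸ m →ₐ[k] l) (z : R ⧸ m) :
    (charPol (LinearMap.mulLeft k z)).map (algebraMap k l) =
      ∏ i ∈ Finset.range (finrank k (R ⧸ m)),
        (Polynomial.X - Polynomial.C (ψ z ^ Fintype.card k ^ i)) := by
  let _ : Field (R ⧸ m) := Ideal.Quotient.field m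
  have : FiniteDimensional k (R ⧸ m) := Module.Finite.of_finite
  rw [charPol_eq_charpoly]
  exact map_charpoly_mulLeft ψ z

end ResidueFields

section Reduction

open CarlitzL Module

variable {k K L : Type*} [Field k] [Fintype k] [Field K] [Algebra k K] [Algebra k[X] K]
  [Algebra (RatFunc k) K] [IsScalarTower k k[X] K] [IsScalarTower k[X] (RatFunc k) K]
  [FiniteDimensional (RatFunc k) K] [Field L] [Algebra K L] [FiniteDimensional K L] [IsGalois K L]
  [Algebra k L] [Algebra k[X] L] [IsScalarTower k k[X] L] [IsScalarTower k[X] K L]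

omit [Fintype k] [Algebra k K] [Algebra (RatFunc k) K] [IsScalarTower k k[X] K]
  [IsScalarTower k[X] (RatFunc k) K] [FiniteDimensional (RatFunc k) K] [FiniteDimensional K L]
  [IsGalois K L] [Algebra k L] [IsScalarTower k k[X] L] in
theorem inclO_injective : Function.Injective (inclO k K L) := fun _ _ h =>
  Subtype.ext ((algebraMap K L).injective (congrArg Subtype.val h))

omit [Fintype k] [Algebra k K] [IsScalarTower k k[X] K] [FiniteDimensional (RatFunc k) K]
  [FiniteDimensional K L] [IsGalois K L] [Algebra k L] [IsScalarTower k k[X] L] in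
theorem ne_bot_of_comap_isMaximal (𝔓 : Ideal (OInt k L))
    (h𝔓 : (𝔓.comap (inclO k K L)).IsMaximal) : 𝔓 ≠ ⊥ := by
  rintro rfl
  refine OInt_isMaximal_ne_bot _ (h𝔭 := h𝔓) ?_
  exact Ideal.comap_bot_of_injective (inclO k K L) inclO_injective

omit [Algebra k K] [IsScalarTower k k[X] K] [IsGalois K L] [Algebra k L] [IsScalarTower k k[X] L]
  in
theorem isMaximal_of_comap_isMaximal (𝔓 : Ideal (OInt k L)) [𝔓.IsPrime]
    (h𝔓 : (𝔓.comap (inclO k K L)).IsMaximal) : 𝔓.IsMaximal := by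
  have := hasFiniteQuotients_OInt_of_tower k K L
  exact Ring.HasFiniteQuotients.maximalOfPrime (ne_bot_of_comap_isMaximal 𝔓 h𝔓)

omit [Algebra k K] [IsScalarTower k k[X] K] [IsGalois K L] [Algebra k L] [IsScalarTower k k[X] L]
  in
theorem finite_quotient_of_comap_isMaximal (𝔓 : Ideal (OInt k L))
    (h𝔓 : (𝔓.comap (inclO k K L)).IsMaximal) : Finite (OInt k L ⧸ 𝔓) := by
  have := hasFiniteQuotients_OInt_of_tower k K L
  exact Ring.HasFiniteQuotients.finiteQuotient (ne_bot_of_comap_isMaximal 𝔓 h𝔓)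

omit [Algebra k K] [IsScalarTower k k[X] K] [IsGalois K L] [Algebra k L] [IsScalarTower k k[X] L]
  in
theorem finite_quotO (𝔭 : Ideal (OInt k K)) [𝔭.IsMaximal] : Finite (quotO L 𝔭) := by
  have := hasFiniteQuotients_OInt_of_tower k K L
  refine Ring.HasFiniteQuotients.finiteQuotient (I := 𝔭.map (inclO k K L)) fun h => ?_
  exact OInt_isMaximal_ne_bot 𝔭 ((Ideal.map_eq_bot_iff_of_injective inclO_injective).1 h)

omit [Algebra k K] [IsScalarTower k k[X] K] in
theorem finite_quotient_OInt (𝔭 : Ideal (OInt k K)) [𝔭.IsMaximal] : Finite (OInt k K ⧸ 𝔭) := by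
  have := hasFiniteQuotients_OInt k K
  exact Ring.HasFiniteQuotients.finiteQuotient (OInt_isMaximal_ne_bot 𝔭)

variable {l : Type*} [Field l] [Algebra k l]

/-- The map `O_L / 𝔭 O_L → l` that is induced by the projection from `O_L` to the residue field `l`
of a prime above `𝔭`. -/
def reduction (𝔭 : Ideal (OInt k K)) (π : OInt k L →ₐ[k] l)
    (h : (RingHom.ker π).comap (inclO k K L) = 𝔭) : quotO L 𝔭 →ₐ[k] l :=
  Ideal.Quotient.liftₐ (𝔭.map (inclO k K L)) π fun _ hx =>
    (Ideal.map_le_iff_le_comap (K := RingHom.ker π)).2 h.ge hx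

/-- The embedding of residue fields `O_K / 𝔭 → l`. -/
def residueEmb (𝔭 : Ideal (OInt k K)) (π : OInt k L →ₐ[k] l)
    (h : (RingHom.ker π).comap (inclO k K L) = 𝔭) : OInt k K ⧸ 𝔭 →ₐ[k] l :=
  Ideal.Quotient.liftₐ 𝔭 (π.comp ((inclO k K L).restrictScalars k)) fun _ hx => h.ge hx

omit [Algebra (RatFunc k) K] [IsScalarTower k[X] (RatFunc k) K] [FiniteDimensional (RatFunc k) K]
  in
theorem isReduction_reduction (𝔭 : Ideal (OInt k K)) [𝔭.IsMaximal] [Finite (OInt k K ⧸ 𝔭)]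
    (𝔓 : Ideal (OInt k L)) [𝔓.IsMaximal] [Finite (OInt k L ⧸ 𝔓)] {π : OInt k L →ₐ[k] l}
    (hπ : Function.Surjective π) (hker : RingHom.ker π = 𝔓)
    (h : (RingHom.ker π).comap (inclO k K L) = 𝔭) (s : decomp (K := K) 𝔓)
    (hs : ∀ x : OInt k L, s • x - x ^ Nat.card (OInt k K ⧸ 𝔭) ∈ 𝔓) :
    IsReduction (galQuot L 𝔭) (reduction 𝔭 π h) (decomp 𝔓) (inert 𝔓) s
      (finrank k (OInt k K ⧸ 𝔭)) := by
  have hmax : (𝔓.comap (inclO k K L)).IsMaximal := by rwa [← hker, h]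
  have hcard := natCard_eq_pow_finrank (k := k) (OInt k K ⧸ 𝔭)
  have hmk : ∀ b : quotO L 𝔭, ∃ x : OInt k L, Ideal.Quotient.mk (𝔭.map (inclO k K L)) x = b :=
    fun b => Ideal.Quotient.mk_surjective b
  have hpr : ∀ (g : Gal(L/K)) (x : OInt k L), reduction 𝔭 π h
      (galQuot L 𝔭 g (Ideal.Quotient.mk (𝔭.map (inclO k K L)) x)) = π (g • x) := fun g x => rfl
  have hpr' : ∀ x : OInt k L, reduction 𝔭 π h (Ideal.Quotient.mk (𝔭.map (inclO k K L)) x) =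
      π x := fun x => rfl
  have heq : ∀ x y : OInt k L, π x = π y ↔ x - y ∈ 𝔓 := fun x y => by
    rw [← hker, RingHom.mem_ker, map_sub, sub_eq_zero]
  have hmkeq : ∀ x y : OInt k L, Ideal.Quotient.mk 𝔓 x = Ideal.Quotient.mk 𝔓 y ↔ π x = π y :=
    fun x y => Ideal.Quotient.eq.trans (heq x y).symm
  let _ := Fintype.ofFinite Gal(L/K)
  constructor
  · intro b hb
    obtain ⟨x, rfl⟩ := hmk b
    refine ⟨Fintype.card Gal(L/K), ?_⟩
    have := pow_card_mem_map_of_smul_mem (G := Gal(L/K)) (inclO k K L).toRingHom exists_inclO_eq 𝔓 x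
      fun g => hker.le (hb g)
    rw [← hker, show (RingHom.ker π).comap (inclO k K L).toRingHom = 𝔭 from h] at this
    exact Ideal.Quotient.eq_zero_iff_mem.2 this
  · intro y hy
    choose y' hy' using fun g => hπ (y g)
    obtain ⟨x, hx⟩ := exists_forall_mk_smul_eq (G := Gal(L/K)) 𝔓
      (fun g => Ideal.Quotient.mk 𝔓 (y' g)) fun γ hγ g b hb => by
        rw [hmkeq, hy'] at hb ⊢
        exact hy γ hγ g (Ideal.Quotient.mk (𝔭.map (inclO k K L)) b) hb
    exact ⟨Ideal.Quotient.mk (𝔭.map (inclO k K L)) x, fun g =>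
      ((hmkeq _ _).1 (hx g)).trans (hy' g)⟩
  · intro γ
    constructor
    · intro hγ b
      obtain ⟨x, rfl⟩ := hmk b
      exact (heq _ _).2 (hγ x)
    · intro hγ x
      exact (heq _ _).1 (hγ (Ideal.Quotient.mk (𝔭.map (inclO k K L)) x))
  · intro b
    obtain ⟨x, rfl⟩ := hmk b
    rw [hpr, hpr', ← hcard, ← map_pow]
    exact (heq _ _).2 (hs x)
  · intro γ hγ
    obtain ⟨i, hi⟩ := exists_pow_of_mem_stabilizer (G := Gal(L/K)) (inclO k K L).toRingHom
      smul_inclO 𝔓 hmax γ hγ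
    refine ⟨i, fun b => ?_⟩
    obtain ⟨x, rfl⟩ := hmk b
    have h1 : 𝔓.comap (inclO k K L).toRingHom = 𝔭 := by rw [← hker]; exact h
    have h2 := hi x
    rw [h1, ← map_pow, hmkeq, map_pow] at h2
    rw [hpr, hpr', ← hcard]
    exact h2
  · exact finrank_quotient_pos k 𝔭
  · exact finrank_quotient_dvd_finrank 𝔭 (residueEmb 𝔭 π h)

variable {F V : Type*} [Field F] [Algebra k F] [FiniteDimensional k F] [AddCommGroup V]
  [Module k V] [Module F V] [IsScalarTower k F V] [FiniteDimensional F V]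

omit [Algebra (RatFunc k) K] [IsScalarTower k[X] (RatFunc k) K] [FiniteDimensional (RatFunc k) K]
  [FiniteDimensional K L] [IsGalois K L] [FiniteDimensional k F] in
theorem map_map_residuePol (𝔭 : Ideal (OInt k K)) [𝔭.IsMaximal]
    [Finite (OInt k K ⧸ 𝔭)] {π : OInt k L →ₐ[k] l}
    (h : (RingHom.ker π).comap (inclO k K L) = 𝔭) {E : Type*} [Field E] [Algebra k E] [Algebra F E]
    [IsScalarTower k F E] (j : l →ₐ[k] E) :
    ((residuePol 𝔭).map (algebraMap k F)).map (algebraMap F E) =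
      ∏ i ∈ Finset.range (finrank k (OInt k K ⧸ 𝔭)), (Polynomial.X - Polynomial.C
        (j (reduction 𝔭 π h (algebraMap k[X] (quotO L 𝔭) Polynomial.X)) ^
          Fintype.card k ^ i)) := by
  rw [Polynomial.map_map, ← IsScalarTower.algebraMap_eq, residuePol,
    map_charPol_mulLeft_quotient 𝔭 (j.comp (residueEmb 𝔭 π h))]
  have : residueEmb 𝔭 π h (algebraMap k[X] (OInt k K ⧸ 𝔭) Polynomial.X) =
      reduction 𝔭 π h (algebraMap k[X] (quotO L 𝔭) Polynomial.X) :=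
    congrArg π ((inclO k K L).commutes Polynomial.X)
  rw [AlgHom.comp_apply, this]

omit [Fintype k] [Algebra (RatFunc k) K] [IsScalarTower k[X] (RatFunc k) K]
  [FiniteDimensional (RatFunc k) K] in
theorem natDegree_map_residuePol (F : Type*) [Field F] [Algebra k F] (𝔭 : Ideal (OInt k K))
    [Finite (OInt k K ⧸ 𝔭)] :
    ((residuePol 𝔭).map (algebraMap k F)).natDegree = finrank k (OInt k K ⧸ 𝔭) := by
  rw [Polynomial.natDegree_map, residuePol, natDegree_charPol]

omit [Algebra (RatFunc k) K] [IsScalarTower k[X] (RatFunc k) K] [FiniteDimensional (RatFunc k) K]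
  [FiniteDimensional K L] [IsGalois K L] in
theorem carlitzFactor_eq_coinvFactor_of_isReduction (ρ : Representation F Gal(L/K) V) {n : ℕ}
    (hn : 0 < n) (𝔭 : Ideal (OInt k K)) [Finite (quotO L 𝔭)] (𝔓 : Ideal (OInt k L))
    (s : decomp (K := K) 𝔓) [FiniteDimensional k l] {E : Type*} [Field E] [Algebra k E]
    [Algebra F E] [IsScalarTower k F E] (j : l →ₐ[k] E) {pr : quotO L 𝔭 →ₐ[k] l} {d : ℕ}
    (H : IsReduction (galQuot L 𝔭) pr (decomp 𝔓) (inert 𝔓) s d)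
    (hdeg : 0 < ((residuePol 𝔭).map (algebraMap k F)).natDegree)
    (hf : ((residuePol 𝔭).map (algebraMap k F)).map (algebraMap F E) =
      ∏ i ∈ Finset.range d, (Polynomial.X - Polynomial.C
        (j (pr (algebraMap k[X] (quotO L 𝔭) Polynomial.X)) ^ Fintype.card k ^ i))) :
    carlitzFactor ρ n 𝔭 = (coinvFactor ρ n 𝔭 𝔓 s : F⸨X⸩) := by
  have : FiniteDimensional F (inertiaCoinv ρ (inert (K := K) 𝔓)) :=
    Module.Finite.of_surjective (coinvMk ρ (inert 𝔓)) (Representation.Coinvariants.mk_surjective _)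
  let b := finBasis F (inertiaCoinv ρ (inert (K := K) 𝔓))
  obtain ⟨c, hc, h1, h2⟩ := charPol_carlitz (ρ := ρ) (j := j) H hn b _ hf
  have hc' : polyToLaurent c ≠ 0 := (map_ne_zero_iff _ polyToLaurent_injective).2 hc
  have h1' : carlitzLiePol ρ n 𝔭 = _ := h1
  have h2' : carlitzPol ρ n 𝔭 = _ := h2
  rw [coinvFactor, eulerFactor_invPoly b hdeg hn, carlitzFactor, h1', h2', map_mul, map_mul,
    mul_div_mul_left _ _ hc']

/-- The local factor of `L(C^{⊗n}, ρ)` is the Euler factor on the coinvariants. -/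
theorem carlitzFactor_eq_coinvFactor (ρ : Representation F Gal(L/K) V) {n : ℕ} (hn : 0 < n)
    (𝔭 : Ideal (OInt k K)) [𝔭.IsMaximal] (𝔓 : Ideal (OInt k L)) [𝔓.IsPrime]
    (h : 𝔓.comap (inclO k K L) = 𝔭) (s : decomp (K := K) 𝔓)
    (hs : ∀ x : OInt k L, s • x - x ^ Nat.card (OInt k K ⧸ 𝔭) ∈ 𝔓) :
    carlitzFactor ρ n 𝔭 = (coinvFactor ρ n 𝔭 𝔓 s : F⸨X⸩) := by
  have hmax : (𝔓.comap (inclO k K L)).IsMaximal := by rwa [h]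
  have := isMaximal_of_comap_isMaximal 𝔓 hmax
  have := finite_quotient_of_comap_isMaximal 𝔓 hmax
  have := finite_quotO (L := L) 𝔭
  have := finite_quotient_OInt 𝔭
  obtain ⟨l, _, _, π, hπ, hker⟩ := exists_residueField k 𝔓
  have hπ𝔭 : (RingHom.ker π).comap (inclO k K L) = 𝔭 := by rw [hker, h]
  have : Finite l := by
    refine Finite.of_surjective (Ideal.Quotient.lift 𝔓 π.toRingHom fun x hx => hker.ge hx) ?_
    exact Ideal.Quotient.lift_surjective_of_surjective _ _ hπ
  have : FiniteDimensional k l := Module.Finite.of_finite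
  refine carlitzFactor_eq_coinvFactor_of_isReduction ρ hn 𝔭 𝔓 s
    (IsAlgClosed.lift : l →ₐ[k] AlgebraicClosure F)
    (isReduction_reduction 𝔭 𝔓 hπ hker hπ𝔭 s hs) ?_ (map_map_residuePol 𝔭 hπ𝔭 _)
  rw [natDegree_map_residuePol]
  exact finrank_quotient_pos k 𝔭

end Reduction

/-! ### The global products -/

section GlobalProduct

open CarlitzL Module

theorem eulerFactor_congr {F W W' : Type*} [Field F] [AddCommGroup W] [Module F W]
    [AddCommGroup W'] [Module F W'] [FiniteDimensional F W] (u : F⟦X⟧) (e : W ≃ₗ[F] W')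
    {φ : W →ₗ[F] W} {φ' : W' →ₗ[F] W'} (h : ∀ x, e (φ x) = φ' (e x)) :
    eulerFactor u φ = eulerFactor u φ' := by
  let b := finBasis F W
  rw [eulerFactor_eq_det b, eulerFactor_eq_det (b.map e)]
  congr 4
  ext i i'
  simp [LinearMap.toMatrix_apply, ← h]

/-- For a trivial subgroup the invariants and the coinvariants are the whole representation. -/
theorem eulerFactor_toInvariants_eq {F H V : Type*} [Field F] [Group H] [AddCommGroup V]
    [Module F V] [FiniteDimensional F V] (τ : Representation F H V) (I : Subgroup H) [I.Normal]
    (hI : ∀ γ ∈ I, γ = 1) (u : F⟦X⟧) (s : H) :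
    eulerFactor u (τ.toInvariants I s) = eulerFactor u (τ.toCoinvariants I s) := by
  let ψ : Representation.invariants (τ.comp I.subtype) →ₗ[F]
      Representation.Coinvariants (τ.comp I.subtype) :=
    Representation.Coinvariants.mk (τ.comp I.subtype) ∘ₗ Submodule.subtype _
  have hτ : ∀ (γ : I) (v : V), (τ.comp I.subtype) γ v = v := fun γ v => by
    rw [MonoidHom.comp_apply, Subgroup.subtype_apply, hI γ γ.2, map_one, Module.End.one_apply]
  have hψ : Function.Bijective ψ := by
    constructor
    · rw [injective_iff_map_eq_zero]
      intro x hx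
      have h1 : (x : V) ∈ Representation.Coinvariants.ker (τ.comp I.subtype) :=
        (Representation.Coinvariants.mk_eq_zero _).1 hx
      have h2 : Representation.Coinvariants.ker (τ.comp I.subtype) ≤ ⊥ := by
        refine Submodule.span_le.2 ?_
        rintro _ ⟨⟨γ, v⟩, rfl⟩
        exact (Submodule.mem_bot F).2 (sub_eq_zero.2 (hτ γ v))
      exact Subtype.ext ((Submodule.mem_bot F).1 (h2 h1))
    · intro y
      obtain ⟨v, rfl⟩ := Representation.Coinvariants.mk_surjective _ y
      exact ⟨⟨v, fun γ => hτ γ v⟩, rfl⟩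
  exact eulerFactor_congr u (LinearEquiv.ofBijective ψ hψ) fun x => rfl

variable {k K L : Type*} [Field k] [Fintype k] [Field K] [Algebra k K] [Algebra k[X] K]
  [Algebra (RatFunc k) K] [IsScalarTower k k[X] K] [IsScalarTower k[X] (RatFunc k) K]
  [FiniteDimensional (RatFunc k) K] [Field L] [Algebra K L] [FiniteDimensional K L] [IsGalois K L]
  [Algebra k L] [Algebra k[X] L] [IsScalarTower k k[X] L] [IsScalarTower k[X] K L]

theorem finite_setOf_finrank_lt (N : ℕ) :
    {𝔭 : MaximalSpectrum (OInt k K) | finrank k (OInt k K ⧸ 𝔭.asIdeal) < N}.Finite := by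
  have := hasFiniteQuotients_OInt k K
  refine ((Ring.HasFiniteQuotients.finite_cardQuot_le (R := OInt k K)
    (Fintype.card k ^ N)).preimage (f := MaximalSpectrum.asIdeal)
    fun _ _ _ _ h => MaximalSpectrum.ext h).subset fun 𝔭 h𝔭 => ?_
  have := 𝔭.isMaximal
  have := finite_quotient_OInt 𝔭.asIdeal
  rw [Set.mem_preimage, Set.mem_ofPred_eq, Submodule.cardQuot_apply,
    natCard_eq_pow_finrank (k := k) (OInt k K ⧸ 𝔭.asIdeal)]
  exact Nat.pow_le_pow_right Fintype.card_pos h𝔭.le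

theorem X_pow_finrank_dvd_eulerFactor_sub_one {F W : Type*} [Field F] [Algebra k F]
    [AddCommGroup W] [Module F W] [FiniteDimensional F W] {n : ℕ} (hn : 0 < n)
    (𝔭 : Ideal (OInt k K)) [𝔭.IsMaximal] (φ : W →ₗ[F] W) :
    PowerSeries.X ^ finrank k (OInt k K ⧸ 𝔭) ∣
      eulerFactor (invPoly ((residuePol 𝔭).map (algebraMap k F)) ^ n) φ - 1 := by
  have := finite_quotient_OInt 𝔭
  refine eulerFactor_sub_one_dvd (finrank_quotient_pos k 𝔭) ?_ φ
  refine dvd_pow ?_ hn.ne'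
  rw [← natDegree_map_residuePol F 𝔭]
  exact X_pow_dvd_invPoly _

/-- An Euler product over the maximal ideals of `O_K` converges, because there are only finitely
many maximal ideals of each degree. -/
theorem exists_hasProd_of_X_pow_finrank_dvd {F : Type*} [Field F]
    (f : MaximalSpectrum (OInt k K) → F⟦X⟧)
    (h : ∀ 𝔭, PowerSeries.X ^ finrank k (OInt k K ⧸ 𝔭.asIdeal) ∣ f 𝔭 - 1) :
    ∃ a : F⟦X⟧, PowerSeries.constantCoeff a = 1 ∧
      HasProd (fun 𝔭 => (f 𝔭 : F⸨X⸩)) (a : F⸨X⸩) := by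
  obtain ⟨a, ha, ha1⟩ := LaurentSeries.exists_hasProd f fun N =>
    (finite_setOf_finrank_lt (k := k) (K := K) N).subset fun 𝔭 h𝔭 => by
      by_contra hlt
      exact h𝔭 ((pow_dvd_pow _ (not_lt.1 hlt)).trans (h 𝔭))
  refine ⟨a, ha1 fun 𝔭 => ?_, ha⟩
  have := 𝔭.isMaximal
  have := finite_quotient_OInt 𝔭.asIdeal
  exact constantCoeff_eq_one_of_dvd (finrank_quotient_pos k 𝔭.asIdeal) (h 𝔭)

omit [Fintype k] [Algebra k K] [IsScalarTower k k[X] K] [IsGalois K L] [Algebra k L]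
  [IsScalarTower k k[X] L] in
theorem exists_smul_sub_ne_zero (g : Gal(L/K)) (hg : g ≠ 1) :
    ∃ x : OInt k L, g • x - x ≠ 0 := by
  by_contra! hcon
  let _ : Algebra (RatFunc k) L := ((algebraMap K L).comp (algebraMap (RatFunc k) K)).toAlgebra
  have : IsScalarTower (RatFunc k) K L := IsScalarTower.of_algebraMap_eq' rfl
  have : IsScalarTower k[X] (RatFunc k) L := IsScalarTower.of_algebraMap_eq fun P => by
    rw [IsScalarTower.algebraMap_apply k[X] K L, IsScalarTower.algebraMap_apply k[X] (RatFunc k) K]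
    rfl
  have : FiniteDimensional (RatFunc k) L := FiniteDimensional.trans (RatFunc k) K L
  have : IsFractionRing (OInt k L) L :=
    integralClosure.isFractionRing_of_finite_extension (RatFunc k) L
  have hcoe : ∀ x : OInt k L, g (x : L) = x := fun x =>
    congrArg Subtype.val (sub_eq_zero.1 (hcon x))
  refine hg (AlgEquiv.ext fun y => ?_)
  obtain ⟨a, b, -, rfl⟩ := IsFractionRing.div_surjective (OInt k L) y
  rw [map_div₀, AlgEquiv.one_apply]
  exact congrArg₂ (· / ·) (hcoe a) (hcoe b)

omit [Algebra k K] [IsScalarTower k k[X] K] [IsGalois K L] [Algebra k L] [IsScalarTower k k[X] L]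
  in
/-- Only finitely many maximal ideals of `O_K` ramify in `L`. -/
theorem finite_setOf_inert_ne_bot (P : MaximalSpectrum (OInt k K) → Ideal (OInt k L))
    (hP : ∀ 𝔭, (P 𝔭).comap (inclO k K L) = 𝔭.asIdeal) :
    {𝔭 | ∃ γ ∈ inert (K := K) (P 𝔭), γ ≠ 1}.Finite := by
  have := hasFiniteQuotients_OInt_of_tower k K L
  have hfin : Finite Gal(L/K) := inferInstance
  have hPinj : Function.Injective P := fun 𝔭 𝔮 h => MaximalSpectrum.ext (by rw [← hP, ← hP, h])
  have h1 : ∀ g : Gal(L/K), {𝔭 | g ≠ 1 ∧ ∀ x, g • x - x ∈ P 𝔭}.Finite := fun g => by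
    by_cases hg : g = 1
    · simp [hg]
    obtain ⟨x, hx⟩ := exists_smul_sub_ne_zero (k := k) g hg
    exact ((Ring.HasFiniteQuotients.finite_setOfPred_mem _ hx).preimage hPinj.injOn).subset
      fun 𝔭 h𝔭 => h𝔭.2 x
  refine (Set.finite_iUnion h1).subset ?_
  rintro 𝔭 ⟨γ, hγ, hne⟩
  exact Set.mem_iUnion.2 ⟨γ, fun h => hne (Subtype.ext h), hγ⟩

variable {F V : Type*} [Field F] [Algebra k F] [FiniteDimensional k F] [AddCommGroup V]
  [Module k V] [Module F V] [IsScalarTower k F V] [FiniteDimensional F V]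

instance (ρ : Representation F Gal(L/K) V) {D : Subgroup Gal(L/K)} (I : Subgroup D) :
    FiniteDimensional F (inertiaCoinv ρ I) :=
  Module.Finite.of_surjective (coinvMk ρ I) (Representation.Coinvariants.mk_surjective _)

omit [FiniteDimensional K L] [IsGalois K L] [Algebra k L] [IsScalarTower k k[X] L]
  [FiniteDimensional k F] [Module k V] [IsScalarTower k F V] in
theorem exists_invFactor_eq_mul_coinvFactor (ρ : Representation F Gal(L/K) V) {n : ℕ} (hn : 0 < n)
    (𝔭 : Ideal (OInt k K)) [𝔭.IsMaximal] (𝔓 : Ideal (OInt k L)) (s : decomp (K := K) 𝔓) :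
    ∃ R : (RatFunc F)ˣ, (invFactor ρ n 𝔭 𝔓 s : F⸨X⸩) =
      (coinvFactor ρ n 𝔭 𝔓 s : F⸨X⸩) * ratToLaurent (R : RatFunc F) ∧
        ((∀ γ ∈ inert (K := K) 𝔓, γ = 1) → R = 1) := by
  have := finite_quotient_OInt 𝔭
  have hdeg : 0 < ((residuePol 𝔭).map (algebraMap k F)).natDegree := by
    rw [natDegree_map_residuePol]
    exact finrank_quotient_pos k 𝔭
  obtain ⟨R₁, h1⟩ := exists_ratToLaurent_eq_eulerFactor hdeg hn
    (Representation.toInvariants (ρ.comp (decomp 𝔓).subtype) (inert 𝔓) s)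
  obtain ⟨R₂, h2⟩ := exists_ratToLaurent_eq_eulerFactor hdeg hn
    (Representation.toCoinvariants (ρ.comp (decomp 𝔓).subtype) (inert 𝔓) s)
  refine ⟨R₁ / R₂, ?_, fun hI => ?_⟩
  · rw [invFactor, coinvFactor, h1, h2, ← map_mul, ← Units.val_mul, mul_div_cancel]
  · rw [eulerFactor_toInvariants_eq _ _ hI, h2] at h1
    rw [div_eq_one]
    exact (Units.ext (ratToLaurent.injective h1)).symm

end GlobalProduct

end

theorem lemma1p5
    {k F K L V : Type*} [Field k] [Fintype k]
    [Field F] [Algebra k F] [FiniteDimensional k F]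
    [Field K] [Algebra k K] [Algebra k[X] K] [Algebra (RatFunc k) K]
    [IsScalarTower k k[X] K] [IsScalarTower k[X] (RatFunc k) K] [FiniteDimensional (RatFunc k) K]
    [Field L] [Algebra K L] [FiniteDimensional K L] [IsGalois K L]
    [Algebra k L] [Algebra k[X] L] [IsScalarTower k k[X] L] [IsScalarTower k[X] K L]
    [AddCommGroup V] [Module k V] [Module F V] [IsScalarTower k F V] [FiniteDimensional F V]
    (ρ : Representation F Gal(L/K) V) (n : ℕ) (hn : 0 < n)
    (P : MaximalSpectrum (CarlitzL.OInt k K) → Ideal (CarlitzL.OInt k L))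
    (hP : ∀ 𝔭, (P 𝔭).IsPrime ∧ (P 𝔭).comap (CarlitzL.inclO k K L) = 𝔭.asIdeal)
    (σ : ∀ 𝔭, CarlitzL.decomp (K := K) (P 𝔭))
    (hσ : ∀ 𝔭 (x : CarlitzL.OInt k L),
      σ 𝔭 • x - x ^ Nat.card (CarlitzL.OInt k K ⧸ 𝔭.asIdeal) ∈ P 𝔭) :
    (Multipliable fun 𝔭 : MaximalSpectrum (CarlitzL.OInt k K) =>
      CarlitzL.carlitzFactor (k := k) ρ n 𝔭.asIdeal) ∧
    HasProd (fun 𝔭 : MaximalSpectrum (CarlitzL.OInt k K) =>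
      (CarlitzL.coinvFactor ρ n 𝔭.asIdeal (P 𝔭) (σ 𝔭) : F⸨X⸩)) (CarlitzL.carlitzLValue (k := k) ρ n) ∧
    (∃ f : F⟦X⟧, PowerSeries.constantCoeff f = 1 ∧ CarlitzL.carlitzLValue (k := k) ρ n = (f : F⸨X⸩)) ∧
    (Multipliable fun 𝔭 : MaximalSpectrum (CarlitzL.OInt k K) =>
      (CarlitzL.invFactor ρ n 𝔭.asIdeal (P 𝔭) (σ 𝔭) : F⸨X⸩)) ∧
    ∃ r : (RatFunc F)ˣ,
      CarlitzL.artinLValue (k := k) ρ n P σ / CarlitzL.carlitzLValue (k := k) ρ n =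
        CarlitzL.ratToLaurent (r : RatFunc F) := by
  have hmax : ∀ 𝔭 : MaximalSpectrum (CarlitzL.OInt k K), 𝔭.asIdeal.IsMaximal := fun 𝔭 => 𝔭.isMaximal
  have heq : (fun 𝔭 : MaximalSpectrum (CarlitzL.OInt k K) =>
      CarlitzL.carlitzFactor (k := k) ρ n 𝔭.asIdeal) =
        fun 𝔭 => (CarlitzL.coinvFactor ρ n 𝔭.asIdeal (P 𝔭) (σ 𝔭) : F⸨X⸩) := by
    funext 𝔭
    have := (hP 𝔭).1
    exact carlitzFactor_eq_coinvFactor ρ hn 𝔭.asIdeal (P 𝔭) (hP 𝔭).2 (σ 𝔭) (hσ 𝔭)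
  obtain ⟨a, ha1, ha⟩ := exists_hasProd_of_X_pow_finrank_dvd
    (fun 𝔭 => CarlitzL.coinvFactor ρ n 𝔭.asIdeal (P 𝔭) (σ 𝔭))
    fun 𝔭 => X_pow_finrank_dvd_eulerFactor_sub_one hn 𝔭.asIdeal _
  have hLa : CarlitzL.carlitzLValue (k := k) ρ n = (a : F⸨X⸩) := by
    rw [CarlitzL.carlitzLValue, heq]
    exact ha.tprod_eq
  have ha0 : (a : F⸨X⸩) ≠ 0 := by
    rw [Ne, map_eq_zero_iff _ HahnSeries.ofPowerSeries_injective]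
    rintro rfl
    simp at ha1
  choose R hR hR1 using fun 𝔭 : MaximalSpectrum (CarlitzL.OInt k K) =>
    exists_invFactor_eq_mul_coinvFactor ρ hn 𝔭.asIdeal (P 𝔭) (σ 𝔭)
  have hfin := finite_setOf_inert_ne_bot P fun 𝔭 => (hP 𝔭).2
  have hprod : HasProd (fun 𝔭 => CarlitzL.ratToLaurent (R 𝔭 : RatFunc F))
      (∏ 𝔭 ∈ hfin.toFinset, CarlitzL.ratToLaurent (R 𝔭 : RatFunc F)) :=
    hasProd_prod_of_ne_finset_one fun 𝔭 h𝔭 => by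
      rw [hR1 𝔭, Units.val_one, map_one]
      intro γ hγ
      by_contra hne
      exact h𝔭 (hfin.mem_toFinset.2 ⟨γ, hγ, hne⟩)
  have hinv := ha.mul hprod
  simp only [← hR] at hinv
  refine ⟨heq ▸ ha.multipliable, hLa ▸ ha, ⟨a, ha1, hLa⟩, hinv.multipliable,
    ∏ 𝔭 ∈ hfin.toFinset, R 𝔭, ?_⟩
  rw [CarlitzL.artinLValue, hinv.tprod_eq, hLa, mul_div_cancel_left₀ _ ha0, Units.coe_prod,
    map_prod]
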